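/- Let $\mathbb G=(\mathbb R^N,\circ)$ be a stratified Lie group (homogeneous Carnot group): a smooth Lie group structure on $\mathbb R^N=\mathbb R^{N_1}\times\dots\times\mathbb R^{N_k}$ such that the dilations $D_\lambda(x)=(\lambda x^{(1)},\lambda^2x^{(2)},\dots,\lambda^kx^{(k)})$, $\lambda>0$, are group automorphisms and such that the left-invariant vector fields $X_1,\dots,X_{N_1}$ with $X_j(0)=\partial/\partial x_j|_0$ satisfy Hörmander's condition: the Lie algebra they generate has rank $N$ at every point. Let $Q=\sum_{i=1}^k iN_i$ be its homogeneous dimension, let $dx$ be Lebesgue measure (which is the Haar measure of $\mathbb G$), and let $|\cdot|:\mathbb G\to[0,\infty)$ be a homogeneous quasi-norm: a continuous function with $|x|=0$ iff $x=0$, $|x^{-1}|=|x|$, and $|D_\lambda x|=\lambda|x|$ for $\lambda>0$. Let $0<s<1<p<\infty$ with $Q>sp$, and let $\Omega\subset\mathbb G$ be open. For measurable $u:\mathbb G\to\mathbb R$ put $$[u]_{s,p,\mathbb G}=\Big(\int_{\mathbb G}\int_{\mathbb G}\frac{|u(x)-u(y)|^p}{|y^{-1}\circ x|^{Q+ps}}\,dx\,dy\Big)^{1/p},\qquad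 \|u\|_{X_0^{s,p}(\Omega)}=\|u\|_{L^p(\Omega)}+[u]_{s,p,\mathbb G}.$$ Let $X_0^{s,p}(\Omega)$ be the closure of $C_c^\infty(\Omega)$ with respect to this norm, that is, the space of all $u\in L^p(\mathbb G)$ with $[u]_{s,p,\mathbb G}<\infty$ and $u=0$ a.e. outside $\Omega$ for which there are $\varphi_n\in C_c^\infty(\Omega)$ (extended by zero) with $\|u-\varphi_n\|_{X_0^{s,p}(\Omega)}\to0$. Let $p_s^*=\frac{Qp}{Q-sp}$. Then: 1. $X_0^{s,p}(\Omega)$ is continuously embedded in $L^r(\Omega)$ for $p\le r\le p_s^*$: there is a constant $C>0$ (depending on $\mathbb G$, $|\cdot|$, $s$, $p$, $\Omega$, but not on $r$ or $u$) such that $X_0^{s,p}(\Omega)\subset L^r(\Omega)$ and $\|u\|_{L^r(\Omega)}\le C\|u\|_{X_0^{s,p}(\Omega)}$ for all $r\in[p,p_s^*]$ and all $u\in X_0^{s,p}(\Omega)$. 2. If moreover $\Omega$ is bounded, then the embedding $X_0^{s,p}(\Omega)\hookrightarrow L^r(\Omega)$ is continuous for every $r\in[1,p_s^*]$, and it is compact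 for every $r\in[1,p_s^*)$, that is, bounded subsets of $X_0^{s,p}(\Omega)$ are relatively compact in $L^r(\Omega)$. -/

import Mathlib

open MeasureTheory
open scoped ContDiff ENNReal

/-- The left-invariant vector field `X_j` of a group law `mul` on `ℝ^N` whose identity is `0`:
`X_j(x) = d(y ↦ x ∘ y)(0) e_j`, so that `X_j(0) = ∂/∂x_j`. -/
noncomputable def leftInvariantField {N : ℕ}
    (mul : (Fin N → ℝ) → (Fin N → ℝ) → (Fin N → ℝ)) (j : Fin N) :
    (Fin N → ℝ) → (Fin N → ℝ) :=
  fun x => fderiv ℝ (mul x) 0 (Pi.single j 1)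

/-- The Lie algebra of vector fields on `ℝ^N` generated by a family `S` of vector fields: the
smallest set of vector fields that contains `S` and is closed under linear combinations and under
the Lie bracket. -/
inductive LieGenerated {N : ℕ} (S : Set ((Fin N → ℝ) → (Fin N → ℝ))) :
    ((Fin N → ℝ) → (Fin N → ℝ)) → Prop
  | base (V : (Fin N → ℝ) → (Fin N → ℝ)) (hV : V ∈ S) : LieGenerated S V
  | zero : LieGenerated S 0
  | add (V W : (Fin N → ℝ) → (Fin N → ℝ)) (hV : LieGenerated S V) (hW : LieGenerated S W) :
      LieGenerated S (V + W)
  | smul (c : ℝ) (V : (Fin N → ℝ) → (Fin N → ℝ)) (hV : LieGenerated S V) :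
      LieGenerated S (c • V)
  | bracket (V W : (Fin N → ℝ) → (Fin N → ℝ)) (hV : LieGenerated S V)
      (hW : LieGenerated S W) : LieGenerated S (VectorField.lieBracket ℝ V W)

/-- A stratified Lie group (homogeneous Carnot group) `(ℝ^N, ∘)`.  The coordinate `x_i` belongs to
the layer number `weight i`, and the coordinates are ordered by layers. -/
structure StratifiedGroup (N : ℕ) where
  /-- the group law `x ∘ y` -/
  mul : (Fin N → ℝ) → (Fin N → ℝ) → (Fin N → ℝ)
  /-- the group inverse -/
  inv : (Fin N → ℝ) → (Fin N → ℝ)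
  mul_assoc : ∀ x y z, mul (mul x y) z = mul x (mul y z)
  /-- The identity is the origin: it is the only point fixed by all dilations. -/
  zero_mul : ∀ x, mul 0 x = x
  mul_zero : ∀ x, mul x 0 = x
  inv_mul : ∀ x, mul (inv x) x = 0
  mul_inv : ∀ x, mul x (inv x) = 0
  contDiff_mul : ContDiff ℝ ∞ (fun z : (Fin N → ℝ) × (Fin N → ℝ) => mul z.1 z.2)
  contDiff_inv : ContDiff ℝ ∞ inv
  /-- the layer of each coordinate -/
  weight : Fin N → ℕ
  weight_pos : ∀ i, 1 ≤ weight i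
  weight_mono : Monotone weight
  /-- The dilations `D_t(x) = (t x⁽¹⁾, t² x⁽²⁾, …, t^k x⁽ᵏ⁾)`, `t > 0`, are automorphisms. -/
  dilation_mul : ∀ t : ℝ, 0 < t → ∀ x y,
    (fun i => t ^ weight i * mul x y i) =
      mul (fun i => t ^ weight i * x i) (fun i => t ^ weight i * y i)
  /-- Hörmander's condition: at every point, the Lie algebra generated by the left-invariant
  vector fields of the first layer has rank `N`. -/
  hormander : ∀ x v : Fin N → ℝ, ∃ V : (Fin N → ℝ) → (Fin N → ℝ),
    LieGenerated {X | ∃ j, weight j = 1 ∧ X = leftInvariantField mul j} V ∧ V x = v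

namespace StratifiedGroup

variable {N : ℕ}

/-- The dilation `D_t`. -/
def dilation (G : StratifiedGroup N) (t : ℝ) (x : Fin N → ℝ) : Fin N → ℝ :=
  fun i => t ^ G.weight i * x i

/-- The homogeneous dimension `Q = ∑ i, weight i = 1 · N₁ + 2 · N₂ + … + k · N_k`. -/
def homDim (G : StratifiedGroup N) : ℕ := ∑ i, G.weight i

/-- Homogeneous (symmetric, continuous) quasi-norms on `G`. -/
structure QuasiNorm (G : StratifiedGroup N) where
  /-- the function `|·|` -/
  toFun : (Fin N → ℝ) → ℝ
  continuous_toFun : Continuous toFun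
  nonneg : ∀ x, 0 ≤ toFun x
  eq_zero_iff : ∀ x, toFun x = 0 ↔ x = 0
  map_inv : ∀ x, toFun (G.inv x) = toFun x
  map_dilation : ∀ t : ℝ, 0 < t → ∀ x, toFun (G.dilation t x) = t * toFun x

variable {G : StratifiedGroup N}

/-- The Gagliardo seminorm
`[u]_{s,p,Ω} = (∫_Ω ∫_Ω |u(x) - u(y)|^p / |y⁻¹ ∘ x|^(Q + ps) dx dy)^(1/p)`, with values in
`[0, ∞]`.  The measure is Lebesgue measure, which is the Haar measure of `G`. -/
noncomputable def gagliardo (q : G.QuasiNorm) (s p : ℝ) (Ω : Set (Fin N → ℝ))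
    (u : (Fin N → ℝ) → ℝ) : ℝ≥0∞ :=
  (∫⁻ y in Ω, ∫⁻ x in Ω,
    ENNReal.ofReal
      (|u x - u y| ^ p / q.toFun (G.mul (G.inv y) x) ^ ((G.homDim : ℝ) + p * s))) ^ (1 / p)

/-- `u ∈ W^{s,p}(Ω)`. -/
def MemW (q : G.QuasiNorm) (s p : ℝ) (Ω : Set (Fin N → ℝ)) (u : (Fin N → ℝ) → ℝ) : Prop :=
  MemLp u (ENNReal.ofReal p) (volume.restrict Ω) ∧ gagliardo q s p Ω u < ⊤

/-- The norm `‖u‖_{L^p(Ω)} + [u]_{s,p,𝔾}` of `X₀^{s,p}(Ω)`. -/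
noncomputable def normX0 (q : G.QuasiNorm) (s p : ℝ) (Ω : Set (Fin N → ℝ))
    (u : (Fin N → ℝ) → ℝ) : ℝ≥0∞ :=
  eLpNorm u (ENNReal.ofReal p) (volume.restrict Ω) + gagliardo q s p Set.univ u

/-- `φ ∈ C_c^∞(Ω)`, extended by zero to the whole group. -/
def IsTestFunction (Ω : Set (Fin N → ℝ)) (φ : (Fin N → ℝ) → ℝ) : Prop :=
  ContDiff ℝ ∞ φ ∧ HasCompactSupport φ ∧ tsupport φ ⊆ Ω

/-- `u ∈ X₀^{s,p}(Ω)`, the closure of `C_c^∞(Ω)` for the norm `‖u‖_{L^p(Ω)} + [u]_{s,p,𝔾}`.  The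
elements are functions on the whole group that vanish almost everywhere outside `Ω`, and two of
them are identified when they agree almost everywhere. -/
def MemX0 (q : G.QuasiNorm) (s p : ℝ) (Ω : Set (Fin N → ℝ)) (u : (Fin N → ℝ) → ℝ) : Prop :=
  MemW q s p Set.univ u ∧ (∀ᵐ x ∂(volume.restrict Ωᶜ), u x = 0) ∧
    ∀ ε : ℝ≥0∞, 0 < ε → ∃ φ, IsTestFunction Ω φ ∧ normX0 q s p Ω (u - φ) < ε

/-- `X₀^{s,p}(Ω) ⊆ L^r(Ω)` with `‖u‖_{L^r(Ω)} ≤ C ‖u‖_{X₀^{s,p}(Ω)}` for all `u`. -/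
def EmbedsWithConst (q : G.QuasiNorm) (s p : ℝ) (Ω : Set (Fin N → ℝ)) (r C : ℝ) : Prop :=
  ∀ u, MemX0 q s p Ω u → MemLp u (ENNReal.ofReal r) (volume.restrict Ω) ∧
    eLpNorm u (ENNReal.ofReal r) (volume.restrict Ω) ≤ ENNReal.ofReal C * normX0 q s p Ω u

/-- The embedding of `X₀^{s,p}(Ω)` into `L^r(Ω)` is continuous. -/
def EmbedsContinuously (q : G.QuasiNorm) (s p : ℝ) (Ω : Set (Fin N → ℝ)) (r : ℝ) : Prop :=
  ∃ C : ℝ, 0 < C ∧ EmbedsWithConst q s p Ω r C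

/-- The embedding of `X₀^{s,p}(Ω)` into `L^r(Ω)`, `r ≥ 1`, is compact: it is continuous and the
image of every ball of `X₀^{s,p}(Ω)` is relatively compact in `L^r(Ω)`. -/
def EmbedsCompactly (q : G.QuasiNorm) (s p : ℝ) (Ω : Set (Fin N → ℝ)) (r : ℝ) (hr : 1 ≤ r) :
    Prop :=
  haveI : Fact (1 ≤ ENNReal.ofReal r) := ⟨ENNReal.one_le_ofReal.2 hr⟩
  EmbedsContinuously q s p Ω r ∧
    ∀ M : ℝ, IsCompact (closure
      {f : Lp ℝ (ENNReal.ofReal r) (volume.restrict Ω) |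
        ∃ u, MemX0 q s p Ω u ∧ normX0 q s p Ω u ≤ ENNReal.ofReal M ∧
          ⇑f =ᵐ[volume.restrict Ω] u})

/-- The critical exponent `p_s^* = Qp / (Q - sp)`. -/
noncomputable def critExp (G : StratifiedGroup N) (s p : ℝ) : ℝ :=
  (G.homDim : ℝ) * p / ((G.homDim : ℝ) - s * p)

end StratifiedGroup

/-!
The proof compares a function with its averages `T_ρ u` over quasi-balls of radius `ρ`, weighted by
the cut-off `max (0, 1 - |y⁻¹ ∘ x| / ρ)`.

*Haar measure.* The determinant of the differential at `0` of the left translation by `a` is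
continuous in `a` and invariant under dilations, hence equal to its value `1` at `a = 0`; so left
translations preserve Lebesgue measure (`lintegral_mul_left`). Dilations scale it by `t ^ Q`, and
the kernel at scale `ρ` has mass proportional to `ρ ^ Q`.

*Sobolev inequality.* Let `D y` be the `L^p` fractional difference of `u` at `y`, so that the
`L^p` norm of `D` is the Gagliardo seminorm. By Hölder's inequality the mean oscillation of `u`
about `y` at scale `ρ` is at most a multiple of `ρ ^ s * D y`, and the average of `|u|` is at most
a multiple of `ρ ^ (-Q / p*) * A`, where `A` is the `L^{p*}` norm of `u`. Optimising over `ρ` gives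
`|u y| ^ p* ≤ C * A ^ (p* - p) * D y ^ p` (`exists_enorm_rpow_critExp_le`), and integrating gives
`A ^ p ≤ C * [u] ^ p` as soon as `A` is finite. Truncating `u` removes the finiteness assumption
(`exists_sobolev`). In particular no approximation by test functions is needed. The remaining
exponents follow from an elementary interpolation, uniformly in `r`.

*Compactness.* The oscillation bound also gives `‖u - T_ρ u‖_p ≤ C * ρ ^ s * [u]`
(`exists_eLpNorm_sub_average_le`). For fixed `ρ` the functions `T_ρ u` are uniformly bounded and
equicontinuous on the compact set `closure Ω`, so by the Arzelà–Ascoli theorem they are uniformly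
close to finitely many functions. Hence bounded sets of `X₀^{s,p}(Ω)` are totally bounded in
`L^p(Ω)` (`exists_finite_discretization`), and, being bounded in `L^{p*}(Ω)`, in `L^r(Ω)` for
every `r < p*`.
-/

open scoped BoundedContinuousFunction

namespace StratifiedGroup

variable {N : ℕ}

/-! ### Invariance of Lebesgue measure under left translations, and its scaling -/

lemma contDiff_mul_left (G : StratifiedGroup N) (a : Fin N → ℝ) : ContDiff ℝ ∞ (G.mul a) :=
  G.contDiff_mul.comp (contDiff_const.prodMk contDiff_id)

lemma hasFDerivAt_mul_left (G : StratifiedGroup N) (a y : Fin N → ℝ) :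
    HasFDerivAt (G.mul a) (fderiv ℝ (G.mul a) y) y :=
  ((G.contDiff_mul_left a).differentiable (by simp) y).hasFDerivAt

/-- The dilation `D_t` as a continuous linear map. -/
noncomputable def dilationL (G : StratifiedGroup N) (t : ℝ) : (Fin N → ℝ) →L[ℝ] (Fin N → ℝ) :=
  ContinuousLinearMap.pi fun i => t ^ G.weight i • ContinuousLinearMap.proj i

lemma dilationL_apply (G : StratifiedGroup N) (t : ℝ) (x : Fin N → ℝ) :
    G.dilationL t x = G.dilation t x := by
  ext i; simp [dilationL, dilation]

lemma det_dilationL (G : StratifiedGroup N) (t : ℝ) : (G.dilationL t).det = t ^ G.homDim := by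
  have h : ((G.dilationL t : (Fin N → ℝ) →L[ℝ] (Fin N → ℝ)) : (Fin N → ℝ) →ₗ[ℝ] (Fin N → ℝ)) =
      LinearMap.pi fun i => (t ^ G.weight i • (LinearMap.id : ℝ →ₗ[ℝ] ℝ)) ∘ₗ LinearMap.proj i := by
    ext x i; simp [dilationL]
  rw [ContinuousLinearMap.det, h, LinearMap.det_pi]
  simp [homDim, Finset.prod_pow_eq_pow_sum]

lemma dilation_dilation_inv (G : StratifiedGroup N) {t : ℝ} (ht : t ≠ 0) (x : Fin N → ℝ) :
    G.dilation t (G.dilation t⁻¹ x) = x := by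
  ext i
  simp [dilation, ht]

/-- The determinant of the differential at the origin of a left translation is invariant under
dilations, since these are automorphisms. -/
lemma det_fderiv_mul_left_dilation (G : StratifiedGroup N) {t : ℝ} (ht : 0 < t)
    (a : Fin N → ℝ) :
    (fderiv ℝ (G.mul (G.dilation t a)) 0).det = (fderiv ℝ (G.mul a) 0).det := by
  have hfun : G.dilationL t ∘ G.mul a = G.mul (G.dilation t a) ∘ G.dilationL t := by
    funext y
    simp only [Function.comp, dilationL_apply]
    exact G.dilation_mul t ht a y
  have h1 : HasFDerivAt (G.dilationL t ∘ G.mul a)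
      ((G.dilationL t).comp (fderiv ℝ (G.mul a) 0)) 0 :=
    (G.dilationL t).hasFDerivAt.comp 0 (G.hasFDerivAt_mul_left a 0)
  have h2 : HasFDerivAt (G.mul (G.dilation t a) ∘ G.dilationL t)
      ((fderiv ℝ (G.mul (G.dilation t a)) 0).comp (G.dilationL t)) 0 := by
    refine HasFDerivAt.comp 0 ?_ (G.dilationL t).hasFDerivAt
    rw [map_zero]
    exact G.hasFDerivAt_mul_left _ 0
  rw [hfun] at h1
  have h3 := congrArg ContinuousLinearMap.det (h2.unique h1)
  simp only [ContinuousLinearMap.det, ContinuousLinearMap.toLinearMap_comp,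
    LinearMap.det_comp] at h3
  have h4 : (LinearMap.det ((G.dilationL t : (Fin N → ℝ) →L[ℝ] (Fin N → ℝ)) :
      (Fin N → ℝ) →ₗ[ℝ] (Fin N → ℝ))) ≠ 0 := by
    have := G.det_dilationL t
    rw [ContinuousLinearMap.det] at this
    rw [this]
    positivity
  rw [mul_comm] at h3
  exact mul_left_cancel₀ h4 h3

lemma det_fderiv_mul_left_zero (G : StratifiedGroup N) (a : Fin N → ℝ) :
    (fderiv ℝ (G.mul a) 0).det = 1 := by
  have hcont : Continuous fun x : Fin N → ℝ => (fderiv ℝ (G.mul x) 0).det := by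
    refine ContinuousLinearMap.continuous_det.comp ?_
    have : ContDiff ℝ 0 fun x : Fin N → ℝ => fderiv ℝ (G.mul x) 0 :=
      ContDiff.fderiv (m := ∞) (f := G.mul) G.contDiff_mul contDiff_const (by simp)
    exact this.continuous
  have hlim : Filter.Tendsto (fun t : ℝ => G.dilation t a) (nhdsWithin 0 (Set.Ioi 0))
      (nhds 0) := by
    have hc : Continuous fun t : ℝ => G.dilation t a := by
      unfold dilation; fun_prop
    have h0 : G.dilation 0 a = 0 := by
      ext i
      simp [dilation, Nat.one_le_iff_ne_zero.1 (G.weight_pos i)]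
    have := (hc.tendsto 0).mono_left (nhdsWithin_le_nhds (s := Set.Ioi 0))
    rwa [h0] at this
  have h1 := (hcont.tendsto 0).comp hlim
  have hid : G.mul 0 = id := funext G.zero_mul
  have h2 : (fderiv ℝ (G.mul 0) 0).det = 1 := by
    rw [hid, fderiv_id]
    simp [ContinuousLinearMap.det]
  rw [h2] at h1
  refine tendsto_nhds_unique (Filter.Tendsto.congr' ?_ tendsto_const_nhds) h1
  filter_upwards [self_mem_nhdsWithin] with t ht
  exact (G.det_fderiv_mul_left_dilation ht a).symm

lemma det_fderiv_mul_left (G : StratifiedGroup N) (a y : Fin N → ℝ) :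
    (fderiv ℝ (G.mul a) y).det = 1 := by
  have hfun : G.mul (G.mul a y) = G.mul a ∘ G.mul y := by
    funext z; exact G.mul_assoc a y z
  have h1 : HasFDerivAt (G.mul a ∘ G.mul y)
      ((fderiv ℝ (G.mul a) y).comp (fderiv ℝ (G.mul y) 0)) 0 := by
    refine HasFDerivAt.comp 0 ?_ (G.hasFDerivAt_mul_left y 0)
    rw [G.mul_zero]
    exact G.hasFDerivAt_mul_left a y
  have h2 := G.hasFDerivAt_mul_left (G.mul a y) 0
  rw [← hfun] at h1
  have h3 := congrArg ContinuousLinearMap.det (h1.unique h2)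
  have h4 := G.det_fderiv_mul_left_zero y
  have h5 := G.det_fderiv_mul_left_zero (G.mul a y)
  simp only [ContinuousLinearMap.det, ContinuousLinearMap.toLinearMap_comp,
    LinearMap.det_comp] at h3 h4 h5 ⊢
  rw [h4, h5, mul_one] at h3
  exact h3

lemma lintegral_mul_left (G : StratifiedGroup N) (a : Fin N → ℝ) (g : (Fin N → ℝ) → ℝ≥0∞) :
    ∫⁻ x, g (G.mul a x) = ∫⁻ x, g x := by
  have hinj : Function.Injective (G.mul a) := fun x y h => by
    have := congrArg (G.mul (G.inv a)) h
    simpa only [← G.mul_assoc, G.inv_mul, G.zero_mul] using this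
  have hsurj : Function.Surjective (G.mul a) := fun y =>
    ⟨G.mul (G.inv a) y, by rw [← G.mul_assoc, G.mul_inv, G.zero_mul]⟩
  have := lintegral_image_eq_lintegral_abs_det_fderiv_mul volume MeasurableSet.univ
    (fun x _ => (G.hasFDerivAt_mul_left a x).hasFDerivWithinAt) hinj.injOn g
  rw [Set.image_univ, hsurj.range_eq] at this
  simpa [G.det_fderiv_mul_left] using this.symm

lemma lintegral_dilation (G : StratifiedGroup N) {t : ℝ} (ht : 0 < t)
    (g : (Fin N → ℝ) → ℝ≥0∞) :
    ∫⁻ x, g x = ENNReal.ofReal (t ^ G.homDim) * ∫⁻ x, g (G.dilation t x) := by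
  have hinj : Function.Injective (G.dilationL t) := fun x y h => by
    have := congrArg (G.dilation t⁻¹) h
    rw [dilationL_apply, dilationL_apply] at this
    have e := G.dilation_dilation_inv (inv_ne_zero ht.ne')
    rw [inv_inv] at e
    rwa [e, e] at this
  have hsurj : Function.Surjective (G.dilationL t) := fun y =>
    ⟨G.dilation t⁻¹ y, by rw [dilationL_apply, G.dilation_dilation_inv ht.ne']⟩
  have := lintegral_image_eq_lintegral_abs_det_fderiv_mul volume MeasurableSet.univ
    (fun x _ => (G.dilationL t).hasFDerivAt.hasFDerivWithinAt) hinj.injOn g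
  rw [Set.image_univ, hsurj.range_eq] at this
  simp only [Measure.restrict_univ, det_dilationL, dilationL_apply] at this
  rw [this, lintegral_const_mul' _ _ ENNReal.ofReal_ne_top, abs_of_pos (by positivity)]

/-! ### The averaging kernel -/

variable {G : StratifiedGroup N}

/-- The continuous cut-off function `z ↦ max (0, 1 - |z| / ρ)`, which lives on the quasi-ball of
radius `ρ` about the origin. -/
noncomputable def cutoff (q : G.QuasiNorm) (ρ : ℝ) (z : Fin N → ℝ) : ℝ :=
  max 0 (1 - q.toFun z / ρ)

/-- The mass of the cut-off function of radius one. -/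
noncomputable def cutoffMass (q : G.QuasiNorm) : ℝ≥0∞ :=
  ∫⁻ z, ENNReal.ofReal (cutoff q 1 z)

lemma cutoff_nonneg (q : G.QuasiNorm) (ρ : ℝ) (z : Fin N → ℝ) : 0 ≤ cutoff q ρ z :=
  le_max_left _ _

lemma cutoff_le_one (q : G.QuasiNorm) {ρ : ℝ} (hρ : 0 < ρ) (z : Fin N → ℝ) :
    cutoff q ρ z ≤ 1 :=
  max_le zero_le_one (sub_le_self _ (div_nonneg (q.nonneg z) hρ.le))

lemma cutoff_eq_zero (q : G.QuasiNorm) {ρ : ℝ} (hρ : 0 < ρ) {z : Fin N → ℝ}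
    (hz : ρ ≤ q.toFun z) : cutoff q ρ z = 0 :=
  max_eq_left (by rw [sub_nonpos]; exact (one_le_div hρ).2 hz)

lemma continuous_cutoff (q : G.QuasiNorm) (ρ : ℝ) : Continuous (cutoff q ρ) :=
  continuous_const.max (continuous_const.sub (q.continuous_toFun.div_const ρ))

lemma lintegral_cutoff (q : G.QuasiNorm) {ρ : ℝ} (hρ : 0 < ρ) :
    ∫⁻ z, ENNReal.ofReal (cutoff q ρ z) = ENNReal.ofReal (ρ ^ G.homDim) * cutoffMass q := by
  rw [G.lintegral_dilation hρ, cutoffMass]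
  simp only [cutoff, q.map_dilation ρ hρ, mul_div_cancel_left₀ _ hρ.ne', div_one]

/-- Small quasi-balls are bounded: by homogeneity it suffices that the quasi-norm is bounded from
below on the unit sphere. -/
lemma exists_quasiBall_subset (q : G.QuasiNorm) :
    ∃ δ : ℝ, 0 < δ ∧ ∀ x, q.toFun x < δ → ‖x‖ < 1 := by
  have hcomp : IsCompact (Metric.sphere (0 : Fin N → ℝ) 1) := isCompact_sphere 0 1
  obtain ⟨δ, hδ, hs⟩ : ∃ δ : ℝ, 0 < δ ∧ ∀ x ∈ Metric.sphere (0 : Fin N → ℝ) 1, δ ≤ q.toFun x := by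
    rcases (Metric.sphere (0 : Fin N → ℝ) 1).eq_empty_or_nonempty with h | h
    · exact ⟨1, one_pos, by simp [h]⟩
    · obtain ⟨x₀, hx₀, hmin⟩ := hcomp.exists_isMinOn h q.continuous_toFun.continuousOn
      refine ⟨q.toFun x₀, (q.nonneg x₀).lt_of_ne' fun h0 => ?_, fun x hx => hmin hx⟩
      rw [q.eq_zero_iff] at h0
      simp [h0] at hx₀
  refine ⟨δ, hδ, fun x hx => ?_⟩
  by_contra! hx1
  have hc : Continuous fun t : ℝ => ‖G.dilation t x‖ := by
    unfold dilation; fun_prop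
  have h0 : ‖G.dilation 0 x‖ = 0 := by
    rw [norm_eq_zero]
    ext i
    simp [dilation, Nat.one_le_iff_ne_zero.1 (G.weight_pos i)]
  have h1 : G.dilation 1 x = x := by ext i; simp [dilation]
  obtain ⟨t, ⟨ht0, ht1⟩, ht⟩ := intermediate_value_Icc zero_le_one hc.continuousOn
    (show (1 : ℝ) ∈ Set.Icc ‖G.dilation 0 x‖ ‖G.dilation 1 x‖ by
      rw [h0, h1]; exact ⟨zero_le_one, hx1⟩)
  have ht0' : 0 < t := by
    refine ht0.lt_of_ne fun h => ?_
    rw [← h] at ht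
    simp only [h0] at ht
    exact zero_ne_one ht
  have := hs (G.dilation t x) (by simpa using ht)
  rw [q.map_dilation t ht0'] at this
  nlinarith [q.nonneg x]

lemma cutoffMass_ne_top (q : G.QuasiNorm) : cutoffMass q ≠ ⊤ := by
  obtain ⟨δ, hδ, hball⟩ := exists_quasiBall_subset q
  have h1 : ∫⁻ z, ENNReal.ofReal (cutoff q δ z) ≤ volume (Metric.ball (0 : Fin N → ℝ) 1) := by
    rw [← lintegral_indicator_one measurableSet_ball]
    refine lintegral_mono fun z => ?_
    by_cases hz : z ∈ Metric.ball (0 : Fin N → ℝ) 1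
    · rw [Set.indicator_of_mem hz]
      exact ENNReal.ofReal_le_one.2 (cutoff_le_one q hδ z)
    · have : δ ≤ q.toFun z := by
        by_contra! h
        exact hz (by simpa using hball z h)
      simp [cutoff_eq_zero q hδ this]
  rw [lintegral_cutoff q hδ] at h1
  intro htop
  rw [htop, ENNReal.mul_top (ENNReal.ofReal_pos.2 (pow_pos hδ _)).ne'] at h1
  exact absurd (top_le_iff.1 h1) measure_ball_lt_top.ne

lemma cutoffMass_ne_zero (q : G.QuasiNorm) : cutoffMass q ≠ 0 := by
  have hc : Continuous fun z => ENNReal.ofReal (cutoff q 1 z) :=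
    ENNReal.continuous_ofReal.comp (continuous_cutoff q 1)
  refine ((lintegral_pos_iff_support hc.measurable).2 ?_).ne'
  refine hc.isOpen_support.measure_pos _ ⟨0, ?_⟩
  simp [cutoff, (q.eq_zero_iff 0).2 rfl]

/-! ### Pointwise control of a function by its averages -/

/-- The inner integral of the Gagliardo seminorm, i.e. the `p`-th power of the fractional
difference of `u` at the point `y`. -/
noncomputable def energy (q : G.QuasiNorm) (s p : ℝ) (u : (Fin N → ℝ) → ℝ) (y : Fin N → ℝ) :
    ℝ≥0∞ :=
  ∫⁻ x, ENNReal.ofReal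
    (|u x - u y| ^ p / q.toFun (G.mul (G.inv y) x) ^ ((G.homDim : ℝ) + p * s))

lemma gagliardo_univ (q : G.QuasiNorm) (s p : ℝ) (u : (Fin N → ℝ) → ℝ) :
    gagliardo q s p Set.univ u = (∫⁻ y, energy q s p u y) ^ (1 / p) := by
  simp [gagliardo, energy]

lemma continuous_mul_left (G : StratifiedGroup N) (a : Fin N → ℝ) : Continuous (G.mul a) :=
  (G.contDiff_mul_left a).continuous

/-- The mass `ρ^Q ∫ cutoff` of the averaging kernel at scale `ρ`. -/
noncomputable def kernelMass (q : G.QuasiNorm) (ρ : ℝ) : ℝ≥0∞ :=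
  ENNReal.ofReal (ρ ^ G.homDim) * cutoffMass q

lemma lintegral_kernel (q : G.QuasiNorm) {ρ : ℝ} (hρ : 0 < ρ) (y : Fin N → ℝ) :
    ∫⁻ x, ENNReal.ofReal (cutoff q ρ (G.mul (G.inv y) x)) = kernelMass q ρ := by
  rw [G.lintegral_mul_left (G.inv y) fun z => ENNReal.ofReal (cutoff q ρ z),
    lintegral_cutoff q hρ, kernelMass]

lemma kernelMass_ne_top (q : G.QuasiNorm) (ρ : ℝ) : kernelMass q ρ ≠ ⊤ :=
  ENNReal.mul_ne_top ENNReal.ofReal_ne_top (cutoffMass_ne_top q)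

lemma kernelMass_ne_zero (q : G.QuasiNorm) {ρ : ℝ} (hρ : 0 < ρ) : kernelMass q ρ ≠ 0 :=
  mul_ne_zero (ENNReal.ofReal_pos.2 (pow_pos hρ _)).ne' (cutoffMass_ne_zero q)

lemma measurable_kernel (q : G.QuasiNorm) (ρ : ℝ) (y : Fin N → ℝ) :
    Measurable fun x => ENNReal.ofReal (cutoff q ρ (G.mul (G.inv y) x)) :=
  (ENNReal.continuous_ofReal.comp
    ((continuous_cutoff q ρ).comp (G.continuous_mul_left _))).measurable

/-- Hölder's inequality for the average of a function. As the kernel is at most one, its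
conjugate power integrates to at most its mass. -/
lemma lintegral_mul_kernel_le (q : G.QuasiNorm) {ρ r : ℝ} (hρ : 0 < ρ) (hr : 1 < r)
    {f : (Fin N → ℝ) → ℝ≥0∞} (hf : AEMeasurable f) (y : Fin N → ℝ) :
    ∫⁻ x, f x * ENNReal.ofReal (cutoff q ρ (G.mul (G.inv y) x)) ≤
      (∫⁻ x, f x ^ r) ^ (1 / r) * kernelMass q ρ ^ (1 - 1 / r) := by
  have hc := Real.HolderConjugate.conjExponent hr
  refine (ENNReal.lintegral_mul_le_Lp_mul_Lq volume hc hf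
    (measurable_kernel q ρ y).aemeasurable).trans ?_
  have h1 : 1 / r.conjExponent = 1 - 1 / r := by
    have := hc.inv_add_inv_eq_one
    rw [one_div, one_div]; linarith
  rw [h1]
  gcongr
  · exact (sub_pos.2 ((div_lt_one (by linarith)).2 hr)).le
  · rw [← lintegral_kernel q hρ y]
    refine lintegral_mono fun x => ENNReal.rpow_le_self_of_le_one ?_ hc.symm.lt.le
    exact ENNReal.ofReal_le_one.2 (cutoff_le_one q hρ _)

/-- The mean oscillation of `u` about `y` at scale `ρ` is controlled by the fractional difference,
because `|y⁻¹ ∘ x| < ρ` on the support of the kernel. -/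
lemma lintegral_oscillation_le (q : G.QuasiNorm) {s p ρ : ℝ} (hs : 0 < s) (hp : 1 < p)
    (hρ : 0 < ρ) {u : (Fin N → ℝ) → ℝ} (hu : AEMeasurable u) (y : Fin N → ℝ) :
    ∫⁻ x, ENNReal.ofReal |u x - u y| * ENNReal.ofReal (cutoff q ρ (G.mul (G.inv y) x)) ≤
      ENNReal.ofReal (ρ ^ (((G.homDim : ℝ) + p * s) / p)) *
        (energy q s p u y ^ (1 / p) * kernelMass q ρ ^ (1 - 1 / p)) := by
  have hp0 : 0 < p := by linarith
  set e : ℝ := (G.homDim : ℝ) + p * s with he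
  have he0 : 0 < e := by positivity
  set f : (Fin N → ℝ) → ℝ≥0∞ := fun x =>
    ENNReal.ofReal (|u x - u y| ^ p / q.toFun (G.mul (G.inv y) x) ^ e) ^ (1 / p) with hf
  have hfm : AEMeasurable f := by
    have h1 : Measurable fun x => q.toFun (G.mul (G.inv y) x) :=
      (q.continuous_toFun.comp (G.continuous_mul_left _)).measurable
    exact ((((hu.sub_const _).abs.pow_const p).div
      (h1.pow_const e).aemeasurable).ennreal_ofReal).pow_const _
  have hfp : ∀ x, f x ^ p =
      ENNReal.ofReal (|u x - u y| ^ p / q.toFun (G.mul (G.inv y) x) ^ e) := fun x => by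
    rw [hf]; simp only; rw [← ENNReal.rpow_mul, one_div_mul_cancel hp0.ne', ENNReal.rpow_one]
  have key := lintegral_mul_kernel_le q hρ hp hfm y
  simp only [hfp] at key
  refine le_trans ?_ (mul_le_mul_right key _)
  rw [← lintegral_const_mul' _ _ ENNReal.ofReal_ne_top]
  refine lintegral_mono fun x => ?_
  rw [← _root_.mul_assoc]
  set z := q.toFun (G.mul (G.inv y) x) with hz
  rcases le_or_gt ρ z with h | h
  · rw [cutoff_eq_zero q hρ h]; simp
  refine mul_le_mul_left ?_ _
  rcases (q.nonneg (G.mul (G.inv y) x)).eq_or_lt with h0 | h0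
  · have h1 : G.mul (G.inv y) x = 0 := (q.eq_zero_iff _).1 h0.symm
    have h2 : x = y := by
      have := congrArg (G.mul y) h1
      rwa [← G.mul_assoc, G.mul_inv, G.zero_mul, G.mul_zero] at this
    simp [h2]
  · have h0' : 0 < z := h0
    rw [hf]
    simp only
    rw [← hz, ENNReal.ofReal_rpow_of_nonneg (by positivity) (by positivity),
      ← ENNReal.ofReal_mul (by positivity)]
    refine ENNReal.ofReal_le_ofReal ?_
    rw [Real.div_rpow (by positivity) (by positivity), ← Real.rpow_mul (abs_nonneg _),
      ← Real.rpow_mul h0'.le, mul_one_div_cancel hp0.ne', Real.rpow_one, mul_one_div,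
      mul_div_assoc', le_div_iff₀ (by positivity), mul_comm]
    gcongr

/-- The two-term pointwise bound at scale `ρ`: oscillation plus size of the average. -/
lemma enorm_mul_kernelMass_le (q : G.QuasiNorm) {s p r ρ : ℝ} (hs : 0 < s) (hp : 1 < p)
    (hr : 1 < r) (hρ : 0 < ρ) {u : (Fin N → ℝ) → ℝ} (hu : AEMeasurable u) (y : Fin N → ℝ) :
    ‖u y‖ₑ * kernelMass q ρ ≤
      ENNReal.ofReal (ρ ^ (((G.homDim : ℝ) + p * s) / p)) *
        (energy q s p u y ^ (1 / p) * kernelMass q ρ ^ (1 - 1 / p)) +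
      (∫⁻ x, ‖u x‖ₑ ^ r) ^ (1 / r) * kernelMass q ρ ^ (1 - 1 / r) := by
  rw [← lintegral_kernel q hρ y, ← lintegral_const_mul' _ _ enorm_ne_top,
    lintegral_kernel q hρ y]
  refine le_trans ?_ (add_le_add (lintegral_oscillation_le q hs hp hρ hu y)
    (lintegral_mul_kernel_le q hρ hr hu.enorm y))
  have hm : AEMeasurable fun x =>
      ENNReal.ofReal |u x - u y| * ENNReal.ofReal (cutoff q ρ (G.mul (G.inv y) x)) :=
    ((hu.sub_const _).abs.ennreal_ofReal).mul (measurable_kernel q ρ y).aemeasurable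
  rw [← lintegral_add_left' hm]
  refine lintegral_mono fun x => ?_
  rw [← add_mul]
  refine mul_le_mul_left ?_ _
  rw [Real.enorm_eq_ofReal_abs, Real.enorm_eq_ofReal_abs,
    ← ENNReal.ofReal_add (abs_nonneg _) (abs_nonneg _)]
  refine ENNReal.ofReal_le_ofReal ?_
  have := abs_sub_abs_le_abs_sub (u y) (u x)
  rw [abs_sub_comm (u y)] at this
  linarith

/-! ### The fractional Sobolev inequality -/

/-- Optimisation over the scale `ρ`: the two terms are balanced at `ρ = (A / D)^(1/(a+b))`. -/
lemma rpow_le_of_forall_scale {a b p P C A D t : ℝ} (ha : 0 < a) (hb : 0 < b) (hC : 0 ≤ C)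
    (hA : 0 < A) (hD : 0 ≤ D) (ht : 0 ≤ t) (hP : 0 < P)
    (hab : b / (a + b) * P = p)
    (h : ∀ ρ : ℝ, 0 < ρ → t ≤ C * (ρ ^ a * D + ρ ^ (-b) * A)) :
    t ^ P ≤ (2 * C) ^ P * A ^ (P - p) * D ^ p := by
  rcases hD.eq_or_lt with h0 | h0
  · have h1 : t ≤ 0 := by
      have hlim : Filter.Tendsto (fun ρ : ℝ => C * (ρ ^ a * D + ρ ^ (-b) * A)) Filter.atTop
          (nhds (C * (0 + 0 * A))) := by
        simp only [← h0, MulZeroClass.mul_zero]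
        exact (tendsto_const_nhds.add ((tendsto_rpow_neg_atTop hb).mul_const A)).const_mul C
      have := ge_of_tendsto hlim
        ((Filter.eventually_gt_atTop 0).mono fun ρ hρ => h ρ hρ)
      simpa using this
    have h2 : t = 0 := le_antisymm h1 ht
    rw [h2, Real.zero_rpow hP.ne']
    positivity
  · have hs : a + b ≠ 0 := by positivity
    have e1 : ((A / D) ^ (1 / (a + b))) ^ a * D = A ^ (a / (a + b)) * D ^ (b / (a + b)) := by
      have : D ^ (b / (a + b)) = D / D ^ (a / (a + b)) := by
        rw [show b / (a + b) = 1 - a / (a + b) by field_simp; ring, Real.rpow_sub h0,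
          Real.rpow_one]
      rw [← Real.rpow_mul (by positivity), one_div_mul_eq_div, Real.div_rpow hA.le h0.le, this]
      ring
    have e2 : ((A / D) ^ (1 / (a + b))) ^ (-b) * A = A ^ (a / (a + b)) * D ^ (b / (a + b)) := by
      have : A ^ (a / (a + b)) = A / A ^ (b / (a + b)) := by
        rw [show a / (a + b) = 1 - b / (a + b) by field_simp; ring, Real.rpow_sub hA,
          Real.rpow_one]
      rw [← Real.rpow_mul (by positivity), mul_neg, one_div_mul_eq_div,
        Real.rpow_neg (by positivity), Real.div_rpow hA.le h0.le, this, inv_div]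
      ring
    have h1 := h ((A / D) ^ (1 / (a + b))) (by positivity)
    rw [e1, e2] at h1
    have h2 : t ≤ 2 * C * (A ^ (a / (a + b)) * D ^ (b / (a + b))) := by linarith
    refine (Real.rpow_le_rpow ht h2 hP.le).trans_eq ?_
    rw [Real.mul_rpow (x := 2 * C) (by positivity) (by positivity),
      Real.mul_rpow (x := A ^ _) (by positivity) (by positivity), ← Real.rpow_mul hA.le, ← Real.rpow_mul h0.le, hab,
      show a / (a + b) * P = P - p by rw [← hab]; field_simp; ring]
    ring

lemma lt_critExp {s p : ℝ} (hs : 0 < s) (hp : 1 < p) (hQ : s * p < (G.homDim : ℝ)) :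
    p < G.critExp s p := by
  rw [critExp, lt_div_iff₀ (by linarith)]
  nlinarith [mul_pos hs (by linarith : 0 < p)]

/-- The pointwise inequality `|u|^{p*} ≤ C A^{p* - p} D^p`, where `A` is the `L^{p*}` norm of `u`
and `D` its fractional difference. -/
lemma exists_enorm_rpow_critExp_le (q : G.QuasiNorm) {s p : ℝ} (hs : 0 < s) (hp : 1 < p)
    (hQ : s * p < (G.homDim : ℝ)) :
    ∃ K : ℝ, 0 < K ∧ ∀ u : (Fin N → ℝ) → ℝ, AEMeasurable u →
      ∫⁻ x, ‖u x‖ₑ ^ G.critExp s p ≠ 0 → ∫⁻ x, ‖u x‖ₑ ^ G.critExp s p ≠ ⊤ → ∀ y,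
        ‖u y‖ₑ ^ G.critExp s p ≤ ENNReal.ofReal K *
          ((∫⁻ x, ‖u x‖ₑ ^ G.critExp s p) ^ (1 / G.critExp s p)) ^ (G.critExp s p - p) *
            energy q s p u y := by
  have hp0 : 0 < p := by linarith
  have hPp := lt_critExp hs hp hQ
  set P := G.critExp s p with hP
  set n : ℝ := (G.homDim : ℝ) with hn
  have hP0 : 0 < P := by linarith
  have hn0 : 0 < n := (mul_pos hs hp0).trans hQ
  set m : ℝ := (cutoffMass q).toReal with hm
  have hm0 : 0 < m := ENNReal.toReal_pos (cutoffMass_ne_zero q) (cutoffMass_ne_top q)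
  set C : ℝ := m ^ (-(1 / p)) + m ^ (-(1 / P)) with hC
  have hC0 : 0 < C := by positivity
  refine ⟨(2 * C) ^ P, by positivity, fun u hu hu0 hut y => ?_⟩
  set A : ℝ≥0∞ := (∫⁻ x, ‖u x‖ₑ ^ P) ^ (1 / P) with hA
  have hA0 : A ≠ 0 := (ENNReal.rpow_pos (pos_iff_ne_zero.2 hu0) hut).ne'
  have hAt : A ≠ ⊤ := ENNReal.rpow_ne_top_of_nonneg (by positivity) hut
  have hAP0 : A ^ (P - p) ≠ 0 := (ENNReal.rpow_pos (pos_iff_ne_zero.2 hA0) hAt).ne'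
  by_cases hE : energy q s p u y = ⊤
  · rw [hE, ENNReal.mul_top]
    · exact le_top
    · exact mul_ne_zero (ENNReal.ofReal_pos.2 (by positivity)).ne' hAP0
  set D : ℝ := (energy q s p u y ^ (1 / p)).toReal with hD
  have hEt : energy q s p u y ^ (1 / p) ≠ ⊤ := ENNReal.rpow_ne_top_of_nonneg (by positivity) hE
  have hscale : ∀ ρ : ℝ, 0 < ρ →
      |u y| ≤ C * (ρ ^ s * D + ρ ^ (-(n / p - s)) * A.toReal) := by
    intro ρ hρ
    have h := enorm_mul_kernelMass_le q hs hp (hp.trans hPp) hρ hu y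
    rw [← hA] at h
    have hMt := kernelMass_ne_top q ρ
    have hM0 := kernelMass_ne_zero q hρ
    have hkm : (kernelMass q ρ).toReal = ρ ^ n * m := by
      rw [kernelMass, ENNReal.toReal_mul, ENNReal.toReal_ofReal (by positivity), hn,
        Real.rpow_natCast]
    have h' := ENNReal.toReal_mono (by finiteness) h
    rw [ENNReal.toReal_add (by finiteness) (by finiteness), ENNReal.toReal_mul,
      ENNReal.toReal_mul, ENNReal.toReal_mul, ENNReal.toReal_mul, ← ENNReal.toReal_rpow (kernelMass q ρ),
      ← ENNReal.toReal_rpow (kernelMass q ρ), hkm, ENNReal.toReal_ofReal (by positivity), ← hD,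
      toReal_enorm, Real.norm_eq_abs] at h'
    have hρn : 0 < ρ ^ n * m := by positivity
    have e1 : ρ ^ ((n + p * s) / p) * (D * (ρ ^ n * m) ^ (1 - 1 / p)) =
        (m ^ (-(1 / p)) * (ρ ^ s * D)) * (ρ ^ n * m) := by
      have : (ρ ^ n * m) ^ (1 - 1 / p) =
          ρ ^ n * m * (ρ ^ (-(n / p)) * m ^ (-(1 / p))) := by
        rw [sub_eq_add_neg, Real.rpow_add hρn, Real.rpow_one,
          Real.mul_rpow (by positivity) hm0.le, ← Real.rpow_mul hρ.le]
        congr 4; ring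
      rw [this, show (n + p * s) / p = n / p + s by field_simp, Real.rpow_add hρ,
        Real.rpow_neg hρ.le]
      have : ρ ^ (n / p) ≠ 0 := by positivity
      field_simp
    have hnP : n * (1 / P) = n / p - s := by
      have : n - s * p ≠ 0 := by linarith
      rw [hP, critExp, ← hn]
      field_simp
    have e2 : A.toReal * (ρ ^ n * m) ^ (1 - 1 / P) =
        (m ^ (-(1 / P)) * (ρ ^ (-(n / p - s)) * A.toReal)) * (ρ ^ n * m) := by
      have : (ρ ^ n * m) ^ (1 - 1 / P) =
          ρ ^ n * m * (ρ ^ (-(n / p - s)) * m ^ (-(1 / P))) := by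
        rw [sub_eq_add_neg, Real.rpow_add hρn, Real.rpow_one,
          Real.mul_rpow (by positivity) hm0.le, ← Real.rpow_mul hρ.le, mul_neg, hnP]
      rw [this]
      ring
    rw [e1, e2, ← add_mul] at h'
    refine (le_of_mul_le_mul_right h' hρn).trans ?_
    have hD0 : 0 ≤ D := ENNReal.toReal_nonneg
    have hA0 : 0 ≤ A.toReal := ENNReal.toReal_nonneg
    rw [mul_add]
    gcongr
    · exact le_add_of_nonneg_right (by positivity)
    · exact le_add_of_nonneg_left (by positivity)
  have hb : 0 < n / p - s := by
    rw [sub_pos, lt_div_iff₀ hp0]; exact hQ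
  have hfin := rpow_le_of_forall_scale (p := p) (P := P) hs hb hC0.le
    (ENNReal.toReal_pos hA0 hAt) ENNReal.toReal_nonneg (abs_nonneg (u y)) hP0 (by
      have : n - s * p ≠ 0 := by linarith
      rw [add_sub_cancel, hP, critExp, ← hn, div_sub' hp0.ne', mul_comm p s]
      field_simp) hscale
  have hDp : ENNReal.ofReal (D ^ p) = energy q s p u y := by
    rw [← ENNReal.ofReal_rpow_of_nonneg ENNReal.toReal_nonneg hp0.le,
      ENNReal.ofReal_toReal hEt, ← ENNReal.rpow_mul, one_div_mul_cancel hp0.ne',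
      ENNReal.rpow_one]
  have hAp : ENNReal.ofReal (A.toReal ^ (P - p)) = A ^ (P - p) := by
    rw [← ENNReal.ofReal_rpow_of_nonneg ENNReal.toReal_nonneg (by linarith),
      ENNReal.ofReal_toReal hAt]
  rw [Real.enorm_eq_ofReal_abs, ENNReal.ofReal_rpow_of_nonneg (abs_nonneg _) hP0.le]
  refine (ENNReal.ofReal_le_ofReal hfin).trans_eq ?_
  rw [ENNReal.ofReal_mul (by positivity), ENNReal.ofReal_mul (by positivity), hDp, hAp]

lemma exists_sobolev_of_finite (q : G.QuasiNorm) {s p : ℝ} (hs : 0 < s) (hp : 1 < p)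
    (hQ : s * p < (G.homDim : ℝ)) :
    ∃ K : ℝ, 0 < K ∧ ∀ u : (Fin N → ℝ) → ℝ, AEMeasurable u →
      ∫⁻ x, ‖u x‖ₑ ^ G.critExp s p ≠ ⊤ →
        (∫⁻ x, ‖u x‖ₑ ^ G.critExp s p) ^ (1 / G.critExp s p) ≤
          ENNReal.ofReal K * gagliardo q s p Set.univ u := by
  obtain ⟨K, hK, h⟩ := exists_enorm_rpow_critExp_le q hs hp hQ
  have hp0 : 0 < p := by linarith
  have hPp := lt_critExp hs hp hQ
  set P := G.critExp s p with hP
  have hP0 : 0 < P := by linarith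
  refine ⟨K ^ (1 / p), by positivity, fun u hu hut => ?_⟩
  by_cases hu0 : ∫⁻ x, ‖u x‖ₑ ^ P = 0
  · rw [hu0, ENNReal.zero_rpow_of_pos (by positivity)]
    exact zero_le
  have h1 := lintegral_mono (μ := volume) (h u hu hu0 hut)
  set I := ∫⁻ x, ‖u x‖ₑ ^ P with hI
  set A : ℝ≥0∞ := I ^ (1 / P) with hA
  have hA0 : A ≠ 0 := (ENNReal.rpow_pos (pos_iff_ne_zero.2 hu0) hut).ne'
  have hAt : A ≠ ⊤ := ENNReal.rpow_ne_top_of_nonneg (by positivity) hut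
  have hAP0 : A ^ (P - p) ≠ 0 := (ENNReal.rpow_pos (pos_iff_ne_zero.2 hA0) hAt).ne'
  have hAPt : A ^ (P - p) ≠ ⊤ := ENNReal.rpow_ne_top_of_nonneg (by linarith) hAt
  rw [lintegral_const_mul' _ _ (by finiteness)] at h1
  have hIA : I = A ^ (P - p) * A ^ p := by
    rw [← ENNReal.rpow_add _ _ hA0 hAt, sub_add_cancel, hA, ← ENNReal.rpow_mul,
      one_div_mul_cancel hP0.ne', ENNReal.rpow_one]
  rw [hIA, mul_comm (ENNReal.ofReal K), _root_.mul_assoc,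
    ENNReal.mul_le_mul_iff_right hAP0 hAPt] at h1
  rw [gagliardo_univ, ← ENNReal.ofReal_rpow_of_nonneg hK.le (by positivity),
    ← ENNReal.mul_rpow_of_nonneg _ _ (by positivity), one_div p, ENNReal.le_rpow_inv_iff hp0]
  exact h1

/-- Post-composition with a contraction, such as a truncation, does not increase the Gagliardo
seminorm. -/
lemma gagliardo_mono (q : G.QuasiNorm) {s p : ℝ} (hp : 0 < p) {u v : (Fin N → ℝ) → ℝ}
    (h : ∀ x y, |v x - v y| ≤ |u x - u y|) :
    gagliardo q s p Set.univ v ≤ gagliardo q s p Set.univ u := by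
  rw [gagliardo_univ, gagliardo_univ]
  refine ENNReal.rpow_le_rpow (lintegral_mono fun y => lintegral_mono fun x => ?_) (by positivity)
  refine ENNReal.ofReal_le_ofReal ?_
  have := q.nonneg (G.mul (G.inv y) x)
  exact div_le_div_of_nonneg_right (Real.rpow_le_rpow (abs_nonneg _) (h x y) hp.le)
    (by positivity)

/-- The fractional Sobolev inequality, for every `p`-integrable function. Truncated functions
have finite `L^{p*}` norm, and Fatou's lemma passes to the limit. -/
lemma exists_sobolev (q : G.QuasiNorm) {s p : ℝ} (hs : 0 < s) (hp : 1 < p)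
    (hQ : s * p < (G.homDim : ℝ)) :
    ∃ K : ℝ, 0 < K ∧ ∀ u : (Fin N → ℝ) → ℝ, MemLp u (ENNReal.ofReal p) volume →
        eLpNorm u (ENNReal.ofReal (G.critExp s p)) volume ≤
          ENNReal.ofReal K * gagliardo q s p Set.univ u := by
  obtain ⟨K, hK, h⟩ := exists_sobolev_of_finite q hs hp hQ
  have hp0 : 0 < p := by linarith
  have hPp := lt_critExp hs hp hQ
  set P := G.critExp s p with hP
  have hP0 : 0 < P := by linarith
  refine ⟨K, hK, fun u hu => ?_⟩
  have hfin : ∫⁻ x, ‖u x‖ₑ ^ p ≠ ⊤ := by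
    have := lintegral_rpow_enorm_lt_top_of_eLpNorm_lt_top (f := u) (p := ENNReal.ofReal p)
      (ENNReal.ofReal_pos.2 hp0).ne' ENNReal.ofReal_ne_top hu.2
    rw [ENNReal.toReal_ofReal hp0.le] at this
    exact this.ne
  let v : ℕ → (Fin N → ℝ) → ℝ := fun k x => max (min (u x) k) (-k)
  have hvm : ∀ k, AEStronglyMeasurable (v k) volume := fun k =>
    ((hu.1.aemeasurable.min aemeasurable_const).max aemeasurable_const).aestronglyMeasurable
  have hv_le : ∀ k x, |v k x| ≤ |u x| ∧ |v k x| ≤ k := fun k x => by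
    have hk : (0 : ℝ) ≤ k := Nat.cast_nonneg k
    simp only [v]
    constructor
    · rcases abs_cases (u x) with hx | hx <;>
      rcases max_cases (min (u x) (k : ℝ)) (-k) with hy | hy <;>
      rcases min_cases (u x) (k : ℝ) with hz | hz <;> rw [abs_le] <;>
      constructor <;> linarith
    · rw [abs_le]
      exact ⟨le_max_right _ _, max_le (min_le_right _ _) (by linarith)⟩
  have hv_sub : ∀ k x y, |v k x - v k y| ≤ |u x - u y| := fun k x y => by
    refine (abs_max_sub_max_le_abs _ _ _).trans ((abs_min_sub_min_le_max _ _ _ _).trans ?_)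
    simp
  have hbound : ∀ k, eLpNorm (v k) (ENNReal.ofReal P) volume ≤
      ENNReal.ofReal K * gagliardo q s p Set.univ u := fun k => by
    rw [eLpNorm_eq_lintegral_rpow_enorm_toReal (ENNReal.ofReal_pos.2 hP0).ne'
      ENNReal.ofReal_ne_top, ENNReal.toReal_ofReal hP0.le]
    refine (h (v k) (hvm k).aemeasurable ?_).trans
      (mul_le_mul_right (gagliardo_mono q hp0 (hv_sub k)) _)
    have hle : ∫⁻ x, ‖v k x‖ₑ ^ P ≤ ∫⁻ x, ENNReal.ofReal ((k : ℝ) ^ (P - p)) * ‖u x‖ₑ ^ p := by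
      refine lintegral_mono fun x => ?_
      simp only
      rw [Real.enorm_eq_ofReal_abs, Real.enorm_eq_ofReal_abs,
        ENNReal.ofReal_rpow_of_nonneg (abs_nonneg _) hP0.le,
        ENNReal.ofReal_rpow_of_nonneg (abs_nonneg _) hp0.le, ← ENNReal.ofReal_mul (by positivity)]
      refine ENNReal.ofReal_le_ofReal ?_
      have e : |v k x| ^ P = |v k x| ^ (P - p) * |v k x| ^ p := by
        rw [← Real.rpow_add_of_nonneg (abs_nonneg _) (by linarith) hp0.le, sub_add_cancel]
      rw [e]
      have h1 := Real.rpow_le_rpow (abs_nonneg _) (hv_le k x).2 (by linarith : 0 ≤ P - p)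
      have h2 := Real.rpow_le_rpow (abs_nonneg _) (hv_le k x).1 hp0.le
      exact mul_le_mul h1 h2 (by positivity) (by positivity)
    rw [lintegral_const_mul' _ _ ENNReal.ofReal_ne_top] at hle
    exact (hle.trans_lt (by finiteness)).ne
  have hlim := Lp.eLpNorm_lim_le_liminf_eLpNorm (p := ENNReal.ofReal P) hvm u
    (Filter.Eventually.of_forall fun x => by
      refine tendsto_const_nhds.congr' ?_
      filter_upwards [Filter.eventually_ge_atTop ⌈|u x|⌉₊] with k hk
      have h1 : |u x| ≤ k := Nat.ceil_le.1 hk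
      rw [abs_le] at h1
      simp only [v]
      rw [min_eq_left h1.2, max_eq_left h1.1])
  refine hlim.trans (Filter.liminf_le_of_le (by isBoundedDefault) fun b hb => ?_)
  obtain ⟨k, hk⟩ := hb.exists
  exact hk.trans (hbound k)

/-! ### Interpolation between Lebesgue spaces -/

/-- A two-term bound that replaces the interpolation inequality; the free parameter `l` weighs the
two exponents against each other. -/
lemma rpow_le_add_rpow {p r P l t : ℝ} (hp : 0 < p) (hpr : p ≤ r) (hrP : r ≤ P) (hl : 0 < l)
    (ht : 0 ≤ t) : t ^ r ≤ l ^ (p - r) * t ^ p + l ^ (P - r) * t ^ P := by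
  have h : (l * t) ^ r ≤ (l * t) ^ p + (l * t) ^ P := by
    have h0 : 0 ≤ l * t := by positivity
    have hP : 0 ≤ (l * t) ^ P := by positivity
    have hp' : 0 ≤ (l * t) ^ p := by positivity
    rcases le_total (l * t) 1 with h1 | h1
    · have := Real.rpow_le_rpow_of_exponent_ge_of_imp h0 h1 hpr (fun _ h => absurd h (by linarith))
      linarith
    · have := Real.rpow_le_rpow_of_exponent_le h1 hrP
      linarith
  rw [Real.mul_rpow hl.le ht, Real.mul_rpow hl.le ht, Real.mul_rpow hl.le ht] at h
  have hlr : 0 < l ^ r := by positivity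
  rw [Real.rpow_sub hl, Real.rpow_sub hl]
  calc t ^ r = (l ^ r * t ^ r) / l ^ r := by field_simp
    _ ≤ (l ^ p * t ^ p + l ^ P * t ^ P) / l ^ r := by gcongr
    _ = _ := by ring

section Interpolation

variable {α : Type*} [MeasurableSpace α] {μ : Measure α}

lemma lintegral_rpow_eq_eLpNorm_rpow {p : ℝ} (hp : 0 < p) (f : α → ℝ) :
    ∫⁻ x, ‖f x‖ₑ ^ p ∂μ = eLpNorm f (ENNReal.ofReal p) μ ^ p := by
  rw [eLpNorm_eq_lintegral_rpow_enorm_toReal (ENNReal.ofReal_pos.2 hp).ne'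
    ENNReal.ofReal_ne_top, ENNReal.toReal_ofReal hp.le, ← ENNReal.rpow_mul,
    one_div_mul_cancel hp.ne', ENNReal.rpow_one]

lemma eLpNorm_rpow_le_add {p r P l : ℝ} (hp : 0 < p) (hpr : p ≤ r) (hrP : r ≤ P) (hl : 0 < l)
    {f : α → ℝ} (hf : AEStronglyMeasurable f μ) :
    eLpNorm f (ENNReal.ofReal r) μ ^ r ≤
      ENNReal.ofReal (l ^ (p - r)) * eLpNorm f (ENNReal.ofReal p) μ ^ p +
        ENNReal.ofReal (l ^ (P - r)) * eLpNorm f (ENNReal.ofReal P) μ ^ P := by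
  have hr : 0 < r := by linarith
  have hP : 0 < P := by linarith
  rw [← lintegral_rpow_eq_eLpNorm_rpow hp, ← lintegral_rpow_eq_eLpNorm_rpow hr,
    ← lintegral_rpow_eq_eLpNorm_rpow hP, ← lintegral_const_mul' _ _ ENNReal.ofReal_ne_top,
    ← lintegral_const_mul' _ _ ENNReal.ofReal_ne_top,
    ← lintegral_add_left' ((hf.aemeasurable.enorm.pow_const p).const_mul _)]
  refine lintegral_mono fun x => ?_
  simp only
  rw [Real.enorm_eq_ofReal_abs, ENNReal.ofReal_rpow_of_nonneg (abs_nonneg _) hp.le,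
    ENNReal.ofReal_rpow_of_nonneg (abs_nonneg _) hr.le,
    ENNReal.ofReal_rpow_of_nonneg (abs_nonneg _) hP.le, ← ENNReal.ofReal_mul (by positivity),
    ← ENNReal.ofReal_mul (by positivity), ← ENNReal.ofReal_add (by positivity) (by positivity)]
  exact ENNReal.ofReal_le_ofReal (rpow_le_add_rpow hp hpr hrP hl (abs_nonneg _))

/-- Interpolation with a constant that does not depend on the intermediate exponent `r`. -/
lemma eLpNorm_le_of_endpoints {p r P K : ℝ} (hp : 1 ≤ p) (hpr : p ≤ r) (hrP : r ≤ P) (hK : 0 ≤ K)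
    {f : α → ℝ} (hf : AEStronglyMeasurable f μ) {B : ℝ≥0∞} (hB : B ≠ ⊤)
    (h1 : eLpNorm f (ENNReal.ofReal p) μ ≤ B)
    (h2 : eLpNorm f (ENNReal.ofReal P) μ ≤ ENNReal.ofReal K * B) :
    eLpNorm f (ENNReal.ofReal r) μ ≤ ENNReal.ofReal (1 + K ^ P) * B := by
  have hp0 : 0 < p := by linarith
  have hr : 0 < r := by linarith
  have hP : 0 < P := by linarith
  rcases eq_or_ne B 0 with hB0 | hB0
  · rw [hB0, nonpos_iff_eq_zero, eLpNorm_eq_zero_iff hf (ENNReal.ofReal_pos.2 hp0).ne'] at h1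
    rw [eLpNorm_congr_ae h1]
    simp
  set b := B.toReal with hb
  have hb0 : 0 < b := ENNReal.toReal_pos hB0 hB
  have hBb : B = ENNReal.ofReal b := (ENNReal.ofReal_toReal hB).symm
  have h := eLpNorm_rpow_le_add hp0 hpr hrP (inv_pos.2 hb0) hf
  have hp1 := ENNReal.rpow_le_rpow h1 hp0.le
  have hP1 := ENNReal.rpow_le_rpow h2 hP.le
  rw [hBb, ENNReal.ofReal_rpow_of_nonneg hb0.le hp0.le] at hp1
  rw [hBb, ← ENNReal.ofReal_mul hK, ENNReal.ofReal_rpow_of_nonneg (by positivity) hP.le] at hP1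
  have h' := h.trans (add_le_add (mul_le_mul_right hp1 _) (mul_le_mul_right hP1 _))
  rw [← ENNReal.ofReal_mul (by positivity), ← ENNReal.ofReal_mul (by positivity),
    ← ENNReal.ofReal_add (by positivity) (by positivity)] at h'
  have hval : b⁻¹ ^ (p - r) * b ^ p + b⁻¹ ^ (P - r) * (K * b) ^ P = (1 + K ^ P) * b ^ r := by
    rw [Real.inv_rpow hb0.le, Real.inv_rpow hb0.le, ← Real.rpow_neg hb0.le, ← Real.rpow_neg hb0.le,
      Real.mul_rpow hK hb0.le, neg_sub, neg_sub, Real.rpow_sub hb0, Real.rpow_sub hb0]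
    field_simp
  have h3 : (1 + K ^ P) * b ^ r ≤ ((1 + K ^ P) * b) ^ r := by
    rw [Real.mul_rpow (by positivity) hb0.le]
    have := Real.self_le_rpow_of_one_le (x := 1 + K ^ P)
      (le_add_of_nonneg_right (by positivity)) (hp.trans hpr)
    gcongr
  rw [hval] at h'
  have h4 := h'.trans (ENNReal.ofReal_le_ofReal h3)
  rw [← ENNReal.ofReal_rpow_of_nonneg (by positivity) hr.le, ENNReal.rpow_le_rpow_iff hr] at h4
  rwa [hBb, ← ENNReal.ofReal_mul (by positivity)]

/-- On a bounded set of `L^P` over a finite measure, smallness in `L^p` forces smallness in `L^r`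
for every `r < P`. -/
lemma exists_eLpNorm_lt_of_eLpNorm_le [IsFiniteMeasure μ] {p r P B ε : ℝ} (hp : 0 < p)
    (hr : 0 < r) (hpP : p < P) (hrP : r < P) (hB : 0 ≤ B) (hε : 0 < ε) :
    ∃ η : ℝ, 0 < η ∧ ∀ f : α → ℝ, AEStronglyMeasurable f μ →
      eLpNorm f (ENNReal.ofReal p) μ ≤ ENNReal.ofReal η →
      eLpNorm f (ENNReal.ofReal P) μ ≤ ENNReal.ofReal B →
      eLpNorm f (ENNReal.ofReal r) μ < ENNReal.ofReal ε := by
  -- It suffices to treat `max r p`, since the measure is finite.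
  set t := max r p with ht
  have htp : p ≤ t := le_max_right _ _
  have htP : t < P := max_lt hrP hpP
  have ht0 : 0 < t := hp.trans_le htp
  have hP0 : 0 < P := hp.trans hpP
  set v : ℝ := (μ Set.univ ^ (1 / r - 1 / t)).toReal with hv
  have hexp : 0 ≤ 1 / r - 1 / t := sub_nonneg.2 (one_div_le_one_div_of_le hr (le_max_left _ _))
  have hvt : μ Set.univ ^ (1 / r - 1 / t) = ENNReal.ofReal v :=
    (ENNReal.ofReal_toReal (ENNReal.rpow_ne_top_of_nonneg hexp (measure_ne_top _ _))).symm
  have hv0 : 0 ≤ v := ENNReal.toReal_nonneg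
  set d : ℝ := ε / (2 * (v + 1)) with hd
  have hd0 : 0 < d := by positivity
  set l : ℝ := (d ^ t / 2 / (B ^ P + 1)) ^ (1 / (P - t)) with hl
  have hPt : 0 < P - t := by linarith
  have hl0 : 0 < l := by positivity
  refine ⟨(d ^ t / 2 / l ^ (p - t)) ^ (1 / p), by positivity, fun f hf h1 h2 => ?_⟩
  have h := eLpNorm_rpow_le_add hp htp htP.le hl0 hf
  have hp1 := ENNReal.rpow_le_rpow h1 hp.le
  have hP1 := ENNReal.rpow_le_rpow h2 hP0.le
  rw [ENNReal.ofReal_rpow_of_nonneg (by positivity) hp.le, ← Real.rpow_mul (by positivity),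
    one_div_mul_cancel hp.ne', Real.rpow_one] at hp1
  rw [ENNReal.ofReal_rpow_of_nonneg hB hP0.le] at hP1
  have h' := h.trans (add_le_add (mul_le_mul_right hp1 _) (mul_le_mul_right hP1 _))
  rw [← ENNReal.ofReal_mul (by positivity), ← ENNReal.ofReal_mul (by positivity),
    ← ENNReal.ofReal_add (by positivity) (by positivity)] at h'
  have e1 : l ^ (p - t) * (d ^ t / 2 / l ^ (p - t)) = d ^ t / 2 := by
    field_simp
  have e2 : l ^ (P - t) * B ^ P ≤ d ^ t / 2 := by
    rw [hl, ← Real.rpow_mul (by positivity), one_div_mul_cancel hPt.ne', Real.rpow_one,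
      div_mul_eq_mul_div, div_le_iff₀ (by positivity)]
    have : 0 < d ^ t := by positivity
    nlinarith
  have h3 := h'.trans (ENNReal.ofReal_le_ofReal (show _ ≤ d ^ t by rw [e1]; linarith))
  rw [← ENNReal.ofReal_rpow_of_nonneg hd0.le ht0.le, ENNReal.rpow_le_rpow_iff ht0] at h3
  have h4 := eLpNorm_le_eLpNorm_mul_rpow_measure_univ
    (ENNReal.ofReal_le_ofReal (le_max_left r p)) hf
  rw [← ht, ENNReal.toReal_ofReal hr.le, ENNReal.toReal_ofReal ht0.le, hvt] at h4
  refine (h4.trans (mul_le_mul_left h3 _)).trans_lt ?_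
  rw [← ENNReal.ofReal_mul hd0.le, ENNReal.ofReal_lt_ofReal_iff hε, hd, div_mul_eq_mul_div,
    div_lt_iff₀ (by positivity)]
  nlinarith

end Interpolation

/-! ### The continuous embeddings -/

variable {q : G.QuasiNorm} {s p : ℝ} {Ω : Set (Fin N → ℝ)}

lemma MemX0.memLp {u : (Fin N → ℝ) → ℝ} (hu : MemX0 q s p Ω u) :
    MemLp u (ENNReal.ofReal p) volume := by
  have := hu.1.1
  rwa [Measure.restrict_univ] at this

lemma MemX0.normX0_ne_top {u : (Fin N → ℝ) → ℝ} (hu : MemX0 q s p Ω u) : normX0 q s p Ω u ≠ ⊤ :=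
  ENNReal.add_ne_top.2 ⟨hu.memLp.restrict Ω |>.2.ne, hu.1.2.ne⟩

lemma exists_embedsWithConst (q : G.QuasiNorm) (hs : 0 < s) (hp : 1 < p)
    (hQ : s * p < (G.homDim : ℝ)) (Ω : Set (Fin N → ℝ)) :
    ∃ C : ℝ, 0 < C ∧ ∀ r : ℝ, p ≤ r → r ≤ G.critExp s p → EmbedsWithConst q s p Ω r C := by
  obtain ⟨K, hK, h⟩ := exists_sobolev q hs hp hQ
  refine ⟨1 + K ^ G.critExp s p, by positivity, fun r hpr hrP u hu => ?_⟩
  have hle : eLpNorm u (ENNReal.ofReal r) (volume.restrict Ω) ≤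
      ENNReal.ofReal (1 + K ^ G.critExp s p) * normX0 q s p Ω u := by
    refine eLpNorm_le_of_endpoints hp.le hpr hrP hK.le hu.memLp.1.restrict hu.normX0_ne_top
      le_self_add ?_
    refine (eLpNorm_mono_measure _ Measure.restrict_le_self).trans ((h u hu.memLp).trans ?_)
    exact mul_le_mul_right le_add_self _
  exact ⟨⟨hu.memLp.1.restrict,
    hle.trans_lt (ENNReal.mul_lt_top ENNReal.ofReal_lt_top hu.normX0_ne_top.lt_top)⟩, hle⟩

lemma embedsContinuously (q : G.QuasiNorm) (hs : 0 < s) (hp : 1 < p)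
    (hQ : s * p < (G.homDim : ℝ)) (hΩ : volume Ω ≠ ⊤) {r : ℝ} (hr : 1 ≤ r)
    (hrP : r ≤ G.critExp s p) : EmbedsContinuously q s p Ω r := by
  rcases le_total p r with hpr | hpr
  · obtain ⟨C, hC, h⟩ := exists_embedsWithConst q hs hp hQ Ω
    exact ⟨C, hC, h r hpr hrP⟩
  set v : ℝ := (volume Ω ^ (1 / r - 1 / p)).toReal with hv
  have hexp : 0 ≤ 1 / r - 1 / p := sub_nonneg.2 (one_div_le_one_div_of_le (by linarith) hpr)
  have hvt : volume Ω ^ (1 / r - 1 / p) = ENNReal.ofReal v :=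
    (ENNReal.ofReal_toReal (ENNReal.rpow_ne_top_of_nonneg hexp hΩ)).symm
  have hv0 : 0 ≤ v := ENNReal.toReal_nonneg
  refine ⟨v + 1, by positivity, fun u hu => ?_⟩
  have hle : eLpNorm u (ENNReal.ofReal r) (volume.restrict Ω) ≤
      ENNReal.ofReal (v + 1) * normX0 q s p Ω u := by
    have h4 := eLpNorm_le_eLpNorm_mul_rpow_measure_univ (ENNReal.ofReal_le_ofReal hpr)
      (hu.memLp.1.restrict (s := Ω))
    rw [ENNReal.toReal_ofReal (by linarith), ENNReal.toReal_ofReal (by linarith),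
      Measure.restrict_apply_univ, hvt, mul_comm] at h4
    exact h4.trans (mul_le_mul' (ENNReal.ofReal_le_ofReal (by linarith)) le_self_add)
  exact ⟨⟨hu.memLp.1.restrict,
    hle.trans_lt (ENNReal.mul_lt_top ENNReal.ofReal_lt_top hu.normX0_ne_top.lt_top)⟩, hle⟩

variable {ρ : ℝ}

/-! ### Averages over small quasi-balls -/

/-- The weighted average of `u` over the quasi-ball of radius `ρ` about `y`, computed with the
values of `u` on `Ω` only. -/
noncomputable def average (q : G.QuasiNorm) (ρ : ℝ) (Ω : Set (Fin N → ℝ))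
    (u : (Fin N → ℝ) → ℝ) (y : Fin N → ℝ) : ℝ :=
  (kernelMass q ρ).toReal⁻¹ * ∫ x in Ω, u x * cutoff q ρ (G.mul (G.inv y) x)

lemma continuous_kernel (q : G.QuasiNorm) (ρ : ℝ) (y : Fin N → ℝ) :
    Continuous fun x => cutoff q ρ (G.mul (G.inv y) x) :=
  (continuous_cutoff q ρ).comp (G.continuous_mul_left _)

lemma integrable_mul_kernel (hρ : 0 < ρ) {ν : Measure (Fin N → ℝ)} {u : (Fin N → ℝ) → ℝ}
    (hu : Integrable u ν) (y : Fin N → ℝ) :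
    Integrable (fun x => u x * cutoff q ρ (G.mul (G.inv y) x)) ν := by
  refine hu.mul_bdd (c := 1) (continuous_kernel q ρ y).aestronglyMeasurable
    (Filter.Eventually.of_forall fun x => ?_)
  rw [Real.norm_of_nonneg (cutoff_nonneg q ρ _)]
  exact cutoff_le_one q hρ _

/-- A function differs from its average by at most its mean oscillation. -/
lemma enorm_sub_average_mul_le (hρ : 0 < ρ) {u : (Fin N → ℝ) → ℝ} (hu : Integrable u)
    (hΩ : MeasurableSet Ω) (hu0 : ∀ᵐ x ∂(volume.restrict Ωᶜ), u x = 0) (y : Fin N → ℝ) :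
    ‖u y - average q ρ Ω u y‖ₑ * kernelMass q ρ ≤
      ∫⁻ x, ENNReal.ofReal |u x - u y| *
        ENNReal.ofReal (cutoff q ρ (G.mul (G.inv y) x)) := by
  have hkint : Integrable fun x => cutoff q ρ (G.mul (G.inv y) x) := by
    refine ⟨(continuous_kernel q ρ y).aestronglyMeasurable, ?_⟩
    rw [hasFiniteIntegral_iff_ofReal (Filter.Eventually.of_forall fun x => cutoff_nonneg q ρ _),
      lintegral_kernel q hρ]
    exact (kernelMass_ne_top q ρ).lt_top
  set m := (kernelMass q ρ).toReal with hm
  have hm0 : 0 < m := ENNReal.toReal_pos (kernelMass_ne_zero q hρ) (kernelMass_ne_top q ρ)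
  have hmk : kernelMass q ρ = ENNReal.ofReal m :=
    (ENNReal.ofReal_toReal (kernelMass_ne_top q ρ)).symm
  have hk : ∫ x, cutoff q ρ (G.mul (G.inv y) x) = m := by
    rw [integral_eq_lintegral_of_nonneg_ae
      (Filter.Eventually.of_forall fun x => cutoff_nonneg q ρ _)
      (continuous_kernel q ρ y).aestronglyMeasurable, lintegral_kernel q hρ]
  have hfull : ∫ x in Ω, u x * cutoff q ρ (G.mul (G.inv y) x) =
      ∫ x, u x * cutoff q ρ (G.mul (G.inv y) x) := by
    refine setIntegral_eq_integral_of_ae_compl_eq_zero ?_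
    have := (ae_restrict_iff' hΩ.compl).1 hu0
    filter_upwards [this] with x hx hxΩ
    rw [hx hxΩ, MulZeroClass.zero_mul]
  have hdiff : (u y - average q ρ Ω u y) * m =
      ∫ x, (u y - u x) * cutoff q ρ (G.mul (G.inv y) x) := by
    have e : (fun x => (u y - u x) * cutoff q ρ (G.mul (G.inv y) x)) = fun x =>
        u y * cutoff q ρ (G.mul (G.inv y) x) - u x * cutoff q ρ (G.mul (G.inv y) x) := by
      funext x; ring
    rw [e, integral_sub (hkint.const_mul _) (integrable_mul_kernel hρ hu y),
      integral_const_mul, hk, average, hfull, ← hm]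
    field_simp
  have hen : ‖u y - average q ρ Ω u y‖ₑ * kernelMass q ρ =
      ‖(u y - average q ρ Ω u y) * m‖ₑ := by
    rw [enorm_mul, hmk, Real.enorm_eq_ofReal hm0.le]
  rw [hen, hdiff]
  refine (enorm_integral_le_lintegral_enorm _).trans (lintegral_mono fun x => ?_)
  simp only
  rw [enorm_mul, Real.enorm_eq_ofReal (cutoff_nonneg q ρ _), Real.enorm_eq_ofReal_abs,
    abs_sub_comm]

/-- Functions of finite seminorm are close in `L^p` to their averages at scale `ρ`, at the
rate `ρ^s`. -/
lemma exists_eLpNorm_sub_average_le (q : G.QuasiNorm) (hs : 0 < s) (hp : 1 < p)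
    (hΩ : MeasurableSet Ω) :
    ∃ c : ℝ, 0 < c ∧ ∀ ρ : ℝ, 0 < ρ → ∀ u : (Fin N → ℝ) → ℝ, Integrable u →
      (∀ᵐ x ∂(volume.restrict Ωᶜ), u x = 0) →
      eLpNorm (u - average q ρ Ω u) (ENNReal.ofReal p) (volume.restrict Ω) ≤
        ENNReal.ofReal (c * ρ ^ s) * gagliardo q s p Set.univ u := by
  have hp0 : 0 < p := by linarith
  set m := (cutoffMass q).toReal with hm
  have hm0 : 0 < m := ENNReal.toReal_pos (cutoffMass_ne_zero q) (cutoffMass_ne_top q)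
  refine ⟨m ^ (-(1 / p)), by positivity, fun ρ hρ u hu hu0 => ?_⟩
  set n : ℝ := (G.homDim : ℝ) with hn
  have hkm : kernelMass q ρ = ENNReal.ofReal (ρ ^ n * m) := by
    rw [kernelMass, ENNReal.ofReal_mul (by positivity), hn, Real.rpow_natCast, hm,
      ENNReal.ofReal_toReal (cutoffMass_ne_top q)]
  have hρn : 0 < ρ ^ n * m := by positivity
  have hconst : ENNReal.ofReal (ρ ^ ((n + p * s) / p)) * kernelMass q ρ ^ (1 - 1 / p) =
      ENNReal.ofReal (m ^ (-(1 / p)) * ρ ^ s) * kernelMass q ρ := by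
    rw [hkm, ENNReal.ofReal_rpow_of_pos hρn, ← ENNReal.ofReal_mul (by positivity),
      ← ENNReal.ofReal_mul (by positivity), sub_eq_add_neg, Real.rpow_add hρn, Real.rpow_one,
      Real.mul_rpow (by positivity) hm0.le, ← Real.rpow_mul hρ.le,
      show (n + p * s) / p = n / p + s by field_simp, Real.rpow_add hρ,
      show n * -(1 / p) = -(n / p) by ring, Real.rpow_neg hρ.le]
    have : ρ ^ (n / p) ≠ 0 := by positivity
    field_simp
  have hpt : ∀ y, ‖(u - average q ρ Ω u) y‖ₑ ≤
      ENNReal.ofReal (m ^ (-(1 / p)) * ρ ^ s) * energy q s p u y ^ (1 / p) := fun y => by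
    have h := (enorm_sub_average_mul_le (q := q) hρ hu hΩ hu0 y).trans
      (lintegral_oscillation_le q hs hp hρ hu.1.aemeasurable y)
    rw [mul_comm (energy q s p u y ^ _), ← _root_.mul_assoc, ← hn, hconst,
      mul_right_comm] at h
    exact (ENNReal.mul_le_mul_iff_left (kernelMass_ne_zero q hρ) (kernelMass_ne_top q ρ)).1 h
  rw [eLpNorm_eq_lintegral_rpow_enorm_toReal (ENNReal.ofReal_pos.2 hp0).ne'
    ENNReal.ofReal_ne_top, ENNReal.toReal_ofReal hp0.le, gagliardo_univ, one_div,
    ENNReal.rpow_inv_le_iff hp0, ENNReal.mul_rpow_of_nonneg _ _ hp0.le, ← ENNReal.rpow_mul,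
    inv_mul_cancel₀ hp0.ne', ENNReal.rpow_one, ← lintegral_const_mul' _ _ (by finiteness)]
  refine (lintegral_mono' Measure.restrict_le_self fun y => ?_)
  refine (ENNReal.rpow_le_rpow (hpt y) hp0.le).trans_eq ?_
  rw [ENNReal.mul_rpow_of_nonneg _ _ hp0.le, ← ENNReal.rpow_mul, one_div_mul_cancel hp0.ne',
    ENNReal.rpow_one, one_div]

/-- The modulus of continuity of an average on a bounded set depends on `u` only through its
`L^1` norm. -/
lemma exists_abs_average_sub_le (q : G.QuasiNorm) (hρ : 0 < ρ) (hΩm : MeasurableSet Ω)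
    (hΩ : Bornology.IsBounded Ω)
    {ε : ℝ} (hε : 0 < ε) :
    ∃ δ : ℝ, 0 < δ ∧ ∀ u : (Fin N → ℝ) → ℝ, IntegrableOn u Ω →
      ∀ y ∈ closure Ω, ∀ y' ∈ closure Ω, dist y y' < δ →
        |average q ρ Ω u y - average q ρ Ω u y'| ≤ ε * ∫ x in Ω, ‖u x‖ := by
  have hK : IsCompact (closure Ω) := hΩ.isCompact_closure
  have hcont : Continuous fun z : (Fin N → ℝ) × (Fin N → ℝ) =>
      cutoff q ρ (G.mul (G.inv z.1) z.2) :=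
    (continuous_cutoff q ρ).comp (G.contDiff_mul.continuous.comp
      ((G.contDiff_inv.continuous.comp continuous_fst).prodMk continuous_snd))
  set m := (kernelMass q ρ).toReal with hm
  have hm0 : 0 < m := ENNReal.toReal_pos (kernelMass_ne_zero q hρ) (kernelMass_ne_top q ρ)
  have huc := (hK.prod hK).uniformContinuousOn_of_continuous hcont.continuousOn
  obtain ⟨δ, hδ, h⟩ := Metric.uniformContinuousOn_iff.1 huc (m * ε) (by positivity)
  refine ⟨δ, hδ, fun u hu y hy y' hy' hyy => ?_⟩
  rw [average, average, ← mul_sub, ← integral_sub (integrable_mul_kernel hρ hu y)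
    (integrable_mul_kernel hρ hu y'), abs_mul, abs_of_pos (inv_pos.2 hm0)]
  have hle : |∫ x in Ω, (u x * cutoff q ρ (G.mul (G.inv y) x) -
      u x * cutoff q ρ (G.mul (G.inv y') x))| ≤ ∫ x in Ω, m * ε * ‖u x‖ := by
    rw [← Real.norm_eq_abs]
    refine norm_integral_le_of_norm_le (hu.norm.const_mul _) ?_
    filter_upwards [ae_restrict_mem hΩm] with x hx
    have hx' := subset_closure hx
    have := h (y, x) ⟨hy, hx'⟩ (y', x) ⟨hy', hx'⟩ (by simpa [Prod.dist_eq] using hyy)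
    rw [Real.dist_eq] at this
    rw [← mul_sub, norm_mul, mul_comm, Real.norm_eq_abs]
    gcongr
  rw [integral_const_mul] at hle
  calc m⁻¹ * _ ≤ m⁻¹ * (m * ε * ∫ x in Ω, ‖u x‖) := by gcongr
    _ = _ := by field_simp

lemma continuousOn_average (q : G.QuasiNorm) (hρ : 0 < ρ) (hΩm : MeasurableSet Ω)
    (hΩ : Bornology.IsBounded Ω) {u : (Fin N → ℝ) → ℝ} (hu : IntegrableOn u Ω) :
    ContinuousOn (average q ρ Ω u) (closure Ω) := by
  rw [Metric.continuousOn_iff]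
  intro y hy ε hε
  have hI : 0 ≤ ∫ x in Ω, ‖u x‖ := integral_nonneg fun x => norm_nonneg _
  obtain ⟨δ, hδ, h⟩ := exists_abs_average_sub_le q hρ hΩm hΩ
    (show 0 < ε / ((∫ x in Ω, ‖u x‖) + 1) by positivity)
  refine ⟨δ, hδ, fun y' hy' hyy => (h u hu y' hy' y hy hyy).trans_lt ?_⟩
  rw [div_mul_eq_mul_div, div_lt_iff₀ (by positivity)]
  nlinarith

lemma abs_average_le (q : G.QuasiNorm) (hρ : 0 < ρ) {u : (Fin N → ℝ) → ℝ}
    (hu : IntegrableOn u Ω) (y : Fin N → ℝ) :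
    |average q ρ Ω u y| ≤ (kernelMass q ρ).toReal⁻¹ * ∫ x in Ω, ‖u x‖ := by
  rw [average, abs_mul, abs_of_nonneg (inv_nonneg.2 ENNReal.toReal_nonneg)]
  refine mul_le_mul_of_nonneg_left ?_ (inv_nonneg.2 ENNReal.toReal_nonneg)
  rw [← Real.norm_eq_abs]
  refine norm_integral_le_of_norm_le hu.norm (Filter.Eventually.of_forall fun x => ?_)
  rw [norm_mul, Real.norm_of_nonneg (cutoff_nonneg q ρ _)]
  exact mul_le_of_le_one_right (norm_nonneg _) (cutoff_le_one q hρ _)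

/-- The averages at a fixed scale of an `L^1`-bounded family are, up to a uniform error, finitely
many functions, by the Arzelà–Ascoli theorem. -/
lemma exists_finite_approx_average (q : G.QuasiNorm) (hρ : 0 < ρ) (hΩm : MeasurableSet Ω)
    (hΩ : Bornology.IsBounded Ω) {B ε : ℝ} (hB : 0 ≤ B) (hε : 0 < ε) :
    ∃ t : Set (closure Ω →ᵇ ℝ), t.Finite ∧ ∀ u : (Fin N → ℝ) → ℝ, IntegrableOn u Ω →
      ∫ x in Ω, ‖u x‖ ≤ B → ∃ g ∈ t, ∀ y : closure Ω, |average q ρ Ω u y - g y| < ε := by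
  have : CompactSpace (closure Ω) := isCompact_iff_compactSpace.1 hΩ.isCompact_closure
  set A : Set (closure Ω →ᵇ ℝ) := {f | ∃ u : (Fin N → ℝ) → ℝ, IntegrableOn u Ω ∧
    ∫ x in Ω, ‖u x‖ ≤ B ∧ ∀ y : closure Ω, f y = average q ρ Ω u y} with hA
  have hcomp : IsCompact (closure A) := by
    refine BoundedContinuousFunction.arzela_ascoli
      (Metric.closedBall 0 ((kernelMass q ρ).toReal⁻¹ * B)) (isCompact_closedBall _ _) A ?_ ?_
    · rintro f y ⟨u, hu, huB, hf⟩
      rw [mem_closedBall_zero_iff, hf y, Real.norm_eq_abs]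
      refine (abs_average_le q hρ hu y).trans ?_
      gcongr
    · intro y
      rw [Metric.equicontinuousAt_iff]
      intro ε hε
      obtain ⟨δ, hδ, h⟩ := exists_abs_average_sub_le q hρ hΩm hΩ
        (show 0 < ε / (B + 1) by positivity)
      refine ⟨δ, hδ, fun y' hy' f => ?_⟩
      obtain ⟨f, u, hu, huB, hf⟩ := f
      simp only
      rw [hf y, hf y', Real.dist_eq]
      rw [dist_comm] at hy'
      refine (h u hu y y.2 y' y'.2 hy').trans_lt ?_
      rw [div_mul_eq_mul_div, div_lt_iff₀ (by positivity)]
      nlinarith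
  obtain ⟨t, -, ht, hcover⟩ := Metric.finite_approx_of_totallyBounded
    (hcomp.totallyBounded.subset subset_closure) ε hε
  refine ⟨t, ht, fun u hu huB => ?_⟩
  let f : closure Ω →ᵇ ℝ := BoundedContinuousFunction.mkOfCompact
    ⟨fun y => average q ρ Ω u y, (continuousOn_average q hρ hΩm hΩ hu).domRestrict⟩
  have hf : f ∈ A := ⟨u, hu, huB, fun y => rfl⟩
  obtain ⟨g, hg, hfg⟩ := Set.mem_iUnion₂.1 (hcover hf)
  refine ⟨g, hg, fun y => ?_⟩
  rw [Metric.mem_ball] at hfg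
  exact (BoundedContinuousFunction.dist_coe_le_dist (f := f) (g := g) y).trans_lt hfg

/-! ### The compact embeddings -/

lemma MemX0.integrableOn (hp : 1 < p) (hΩ : volume Ω ≠ ⊤) {u : (Fin N → ℝ) → ℝ}
    (hu : MemX0 q s p Ω u) : IntegrableOn u Ω := by
  have : IsFiniteMeasure (volume.restrict Ω) := isFiniteMeasure_restrict.2 hΩ
  exact (hu.memLp.restrict Ω).integrable (ENNReal.one_le_ofReal.2 hp.le)

lemma MemX0.integrable (hp : 1 < p) (hΩ : volume Ω ≠ ⊤) {u : (Fin N → ℝ) → ℝ}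
    (hu : MemX0 q s p Ω u) : Integrable u := by
  have h0 : IntegrableOn u Ωᶜ :=
    integrableOn_zero.congr (Filter.EventuallyEq.symm hu.2.1)
  rw [← integrableOn_univ, ← Set.union_compl_self Ω]
  exact (hu.integrableOn hp hΩ).union h0

lemma exists_integral_norm_le (q : G.QuasiNorm) (s : ℝ) (hp : 1 < p) (hΩ : volume Ω ≠ ⊤)
    {M : ℝ} (hM : 0 ≤ M) :
    ∃ B : ℝ, 0 ≤ B ∧ ∀ u, MemX0 q s p Ω u → normX0 q s p Ω u ≤ ENNReal.ofReal M →
      ∫ x in Ω, ‖u x‖ ≤ B := by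
  have hexp : 0 ≤ 1 - 1 / p := by
    rw [sub_nonneg, div_le_one (by linarith)]; exact hp.le
  refine ⟨M * (volume Ω ^ (1 - 1 / p)).toReal, by positivity, fun u hu huM => ?_⟩
  have h4 := eLpNorm_le_eLpNorm_mul_rpow_measure_univ (ENNReal.one_le_ofReal.2 hp.le)
    (hu.memLp.1.restrict (s := Ω))
  rw [Measure.restrict_apply_univ, ENNReal.toReal_ofReal (by linarith), ENNReal.toReal_one,
    one_div_one] at h4
  have h5 := h4.trans (mul_le_mul_left (le_self_add.trans huM) _)
  rw [integral_norm_eq_lintegral_enorm hu.memLp.1.restrict, ← eLpNorm_one_eq_lintegral_enorm]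
  refine (ENNReal.toReal_mono ?_ h5).trans_eq ?_
  · exact ENNReal.mul_ne_top ENNReal.ofReal_ne_top (ENNReal.rpow_ne_top_of_nonneg hexp hΩ)
  · rw [ENNReal.toReal_mul, ENNReal.toReal_ofReal hM]

/-- Bounded subsets of `X₀^{s,p}(Ω)` are totally bounded in `L^p(Ω)`: they split into finitely many
classes of small `L^p` diameter, according to the function that approximates the average. -/
lemma exists_finite_discretization (q : G.QuasiNorm) (hs : 0 < s) (hp : 1 < p)
    (hΩm : MeasurableSet Ω) (hΩ : Bornology.IsBounded Ω) {M η : ℝ} (hM : 0 ≤ M) (hη : 0 < η) :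
    ∃ t : Set (closure Ω →ᵇ ℝ), t.Finite ∧ ∃ F : ((Fin N → ℝ) → ℝ) → (closure Ω →ᵇ ℝ),
      (∀ u, MemX0 q s p Ω u → normX0 q s p Ω u ≤ ENNReal.ofReal M → F u ∈ t) ∧
      ∀ u v, MemX0 q s p Ω u → normX0 q s p Ω u ≤ ENNReal.ofReal M →
        MemX0 q s p Ω v → normX0 q s p Ω v ≤ ENNReal.ofReal M → F u = F v →
          eLpNorm (u - v) (ENNReal.ofReal p) (volume.restrict Ω) ≤ ENNReal.ofReal η := by
  classical
  have hp0 : 0 < p := by linarith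
  have hΩt : volume Ω ≠ ⊤ := hΩ.measure_lt_top.ne
  obtain ⟨c, hc, havg⟩ := exists_eLpNorm_sub_average_le q hs hp hΩm
  obtain ⟨B, hB, hBu⟩ := exists_integral_norm_le q s hp hΩt hM
  set v : ℝ := (volume Ω ^ p⁻¹).toReal with hv
  have hvt : volume Ω ^ p⁻¹ = ENNReal.ofReal v :=
    (ENNReal.ofReal_toReal (ENNReal.rpow_ne_top_of_nonneg (by positivity) hΩt)).symm
  have hv0 : 0 ≤ v := ENNReal.toReal_nonneg
  -- The scale makes `c * ρ ^ s * M ≤ η / 4`, and the uniform error makes `v * 2 * e ≤ η / 2`.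
  set ρ : ℝ := (η / (4 * c * (M + 1))) ^ s⁻¹ with hρ
  have hρ0 : 0 < ρ := by positivity
  have hcρ : c * ρ ^ s * M ≤ η / 4 := by
    rw [hρ, ← Real.rpow_mul (by positivity), inv_mul_cancel₀ hs.ne', Real.rpow_one]
    have : c * (η / (4 * c * (M + 1))) * M = η / 4 * (M / (M + 1)) := by field_simp
    rw [this]
    refine mul_le_of_le_one_right (by positivity) ((div_le_one (by positivity)).2 (by linarith))
  set e : ℝ := η / (4 * (v + 1)) with he
  have he0 : 0 < e := by positivity
  have hve : v * (2 * e) ≤ η / 2 := by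
    have : v * (2 * e) = η / 2 * (v / (v + 1)) := by rw [he]; field_simp; norm_num
    rw [this]
    refine mul_le_of_le_one_right (by positivity) ((div_le_one (by positivity)).2 (by linarith))
  obtain ⟨t, ht, hF⟩ := exists_finite_approx_average q hρ0 hΩm hΩ hB he0
  choose! F hFt hFe using hF
  refine ⟨t, ht, F, fun u hu huM => hFt u (hu.integrableOn hp hΩt) (hBu u hu huM),
    fun u w hu huM hw hwM hFuw => ?_⟩
  set T := average q ρ Ω with hT
  have hclose : ∀ f, MemX0 q s p Ω f → normX0 q s p Ω f ≤ ENNReal.ofReal M →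
      eLpNorm (f - T f) (ENNReal.ofReal p) (volume.restrict Ω) ≤ ENNReal.ofReal (η / 4) := by
    intro f hf hfM
    refine (havg ρ hρ0 f (hf.integrable hp hΩt) hf.2.1).trans ?_
    refine (mul_le_mul_right (le_add_self.trans hfM) _).trans ?_
    rw [← ENNReal.ofReal_mul (by positivity)]
    exact ENNReal.ofReal_le_ofReal hcρ
  have hTm : ∀ f, MemX0 q s p Ω f → AEStronglyMeasurable (T f) (volume.restrict Ω) :=
    fun f hf => ((continuousOn_average q hρ0 hΩm hΩ (hf.integrableOn hp hΩt)).mono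
      subset_closure).aestronglyMeasurable hΩm
  have hmid : eLpNorm (T u - T w) (ENNReal.ofReal p) (volume.restrict Ω) ≤
      ENNReal.ofReal (η / 2) := by
    have hae : ∀ᵐ x ∂(volume.restrict Ω), ‖(T u - T w) x‖ ≤ 2 * e := by
      filter_upwards [ae_restrict_mem hΩm] with x hx
      have h1 := hFe u (hu.integrableOn hp hΩt) (hBu u hu huM) ⟨x, subset_closure hx⟩
      have h2 := hFe w (hw.integrableOn hp hΩt) (hBu w hw hwM) ⟨x, subset_closure hx⟩
      rw [hFuw] at h1
      rw [abs_lt] at h1 h2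
      rw [Pi.sub_apply, Real.norm_eq_abs, abs_le]
      constructor <;> linarith [h1.1, h1.2, h2.1, h2.2]
    have := eLpNorm_le_of_ae_bound (p := ENNReal.ofReal p) hae
    rw [Measure.restrict_apply_univ, ENNReal.toReal_ofReal hp0.le, hvt,
      ← ENNReal.ofReal_mul hv0] at this
    exact this.trans (ENNReal.ofReal_le_ofReal hve)
  have hsplit : u - w = (u - T u) - (w - T w) + (T u - T w) := by abel
  have h1p : 1 ≤ ENNReal.ofReal p := ENNReal.one_le_ofReal.2 hp.le
  have hum := hu.memLp.1.restrict (s := Ω)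
  have hwm := hw.memLp.1.restrict (s := Ω)
  rw [hsplit]
  refine (eLpNorm_add_le ((hum.sub (hTm u hu)).sub (hwm.sub (hTm w hw)))
    ((hTm u hu).sub (hTm w hw)) h1p).trans ?_
  refine (add_le_add ((eLpNorm_sub_le (hum.sub (hTm u hu)) (hwm.sub (hTm w hw)) h1p).trans
    (add_le_add (hclose u hu huM) (hclose w hw hwM))) hmid).trans_eq ?_
  rw [← ENNReal.ofReal_add (by positivity) (by positivity),
    ← ENNReal.ofReal_add (by positivity) (by positivity)]
  congr 1
  ring

lemma embedsCompactly (q : G.QuasiNorm) (hs : 0 < s) (hp : 1 < p)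
    (hQ : s * p < (G.homDim : ℝ)) (hΩm : MeasurableSet Ω) (hΩ : Bornology.IsBounded Ω) {r : ℝ}
    (hr : 1 ≤ r) (hrP : r < G.critExp s p) : EmbedsCompactly q s p Ω r hr := by
  have hΩt : volume Ω ≠ ⊤ := hΩ.measure_lt_top.ne
  have hPp := lt_critExp hs hp hQ
  have : IsFiniteMeasure (volume.restrict Ω) := isFiniteMeasure_restrict.2 hΩt
  have : Fact (1 ≤ ENNReal.ofReal r) := ⟨ENNReal.one_le_ofReal.2 hr⟩
  refine ⟨embedsContinuously q hs hp hQ hΩt hr hrP.le, fun M => ?_⟩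
  refine TotallyBounded.isCompact_of_isClosed (TotallyBounded.closure ?_) isClosed_closure
  obtain ⟨K, hK, hSob⟩ := exists_sobolev q hs hp hQ
  set M' := max M 0 with hM'
  have hM0 : 0 ≤ M' := le_max_right _ _
  have hMM : ENNReal.ofReal M ≤ ENNReal.ofReal M' := ENNReal.ofReal_le_ofReal (le_max_left _ _)
  refine Metric.totallyBounded_of_finite_discretization fun ε hε => ?_
  obtain ⟨η, hη, hinterp⟩ := exists_eLpNorm_lt_of_eLpNorm_le (μ := volume.restrict Ω)
    (p := p) (r := r) (by linarith) (by linarith) hPp hrP (B := 2 * (K * M')) (by positivity) hε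
  obtain ⟨t, ht, F, hFt, hF⟩ := exists_finite_discretization q hs hp hΩm hΩ hM0 hη
  choose u hu huM hfu using fun f : {f : Lp ℝ (ENNReal.ofReal r) (volume.restrict Ω) |
    ∃ u, MemX0 q s p Ω u ∧ normX0 q s p Ω u ≤ ENNReal.ofReal M ∧
      ⇑f =ᵐ[volume.restrict Ω] u} => f.2
  refine ⟨t, ht.fintype, fun f => ⟨F (u f), hFt _ (hu f) ((huM f).trans hMM)⟩,
    fun f g hfg => ?_⟩
  have hcrit : ∀ f, eLpNorm (u f) (ENNReal.ofReal (G.critExp s p)) (volume.restrict Ω) ≤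
      ENNReal.ofReal (K * M') := fun f => by
    refine (eLpNorm_mono_measure _ Measure.restrict_le_self).trans
      ((hSob (u f) (hu f).memLp).trans ?_)
    rw [ENNReal.ofReal_mul hK.le]
    exact mul_le_mul_right (le_add_self.trans ((huM f).trans hMM)) _
  have hm : ∀ f, AEStronglyMeasurable (u f) (volume.restrict Ω) :=
    fun f => (hu f).memLp.1.restrict
  have hsmall := hinterp (u f - u g) ((hm f).sub (hm g))
    (hF _ _ (hu f) ((huM f).trans hMM) (hu g) ((huM g).trans hMM) (Subtype.ext_iff.1 hfg)) (by
      refine (eLpNorm_sub_le (hm f) (hm g)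
        (ENNReal.one_le_ofReal.2 (hp.le.trans hPp.le))).trans ?_
      refine (add_le_add (hcrit f) (hcrit g)).trans_eq ?_
      rw [← ENNReal.ofReal_add (by positivity) (by positivity), two_mul])
  rw [Lp.dist_def, eLpNorm_congr_ae ((hfu f).sub (hfu g))]
  exact (ENNReal.toReal_lt_toReal hsmall.ne_top ENNReal.ofReal_ne_top).2 hsmall |>.trans_eq
    (ENNReal.toReal_ofReal hε.le)

end StratifiedGroup

theorem theorem1p1 {N : ℕ} (G : StratifiedGroup N) (q : G.QuasiNorm)
    (s p : ℝ) (hs0 : 0 < s) (hs1 : s < 1) (hp : 1 < p) (hQ : s * p < (G.homDim : ℝ))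
    (Ω : Set (Fin N → ℝ)) (hΩ : IsOpen Ω) :
    (∃ C : ℝ, 0 < C ∧ ∀ r : ℝ, p ≤ r → r ≤ G.critExp s p →
      StratifiedGroup.EmbedsWithConst q s p Ω r C) ∧
    (Bornology.IsBounded Ω →
      (∀ r : ℝ, 1 ≤ r → r ≤ G.critExp s p →
        StratifiedGroup.EmbedsContinuously q s p Ω r) ∧
      (∀ r : ℝ, ∀ hr : 1 ≤ r, r < G.critExp s p →
        StratifiedGroup.EmbedsCompactly q s p Ω r hr)) :=
  ⟨StratifiedGroup.exists_embedsWithConst q hs0 hp hQ Ω, fun hb =>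
    ⟨fun _ hr hrP => StratifiedGroup.embedsContinuously q hs0 hp hQ hb.measure_lt_top.ne hr hrP,
      fun _ hr hrP => StratifiedGroup.embedsCompactly q hs0 hp hQ hΩ.measurableSet hb hr hrP⟩⟩
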